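/- Let $n\ge 1$. Equip $\mathbb R^{2n}$, with coordinates $(x_1,y_1,\dots,x_n,y_n)$, with the standard symplectic form $\omega_n=\sum_{j=1}^n dx_j\wedge dy_j$. For $b\ge 0$ let $B^{2n}(b)\subset\mathbb R^{2n}$ be the closed ball of radius $\sqrt{b/\pi}$ centred at the origin. For $a>0$ let $T(a)\subset\mathbb R^2$ be the boundary of the disc of area $a$ centred at the origin, and for a vector $\mathbf a=(a_1,\dots,a_n)$ with positive components let $T(\mathbf a)=T(a_1)\times\dots\times T(a_n)\subset\mathbb R^{2n}$. A Hamiltonian isotopy of $\mathbb R^{2n}$ is a family $\{\Phi_s\}_{s\in[0,1]}$ with $\Phi_0=\mathrm{id}$ that is the flow of the vector fields $X_s$ given by $\omega_n(X_s,\cdot)=dH_s$ for a family of smooth functions $H_s$ on $\mathbb R^{2n}$ depending smoothly on $s\in[0,1]$, where each $\Phi_s$ is assumed to be a well-defined diffeomorphism of $\mathbb R^{2n}$. We say that $L\subset\mathbb R^{2n}$ is Hamiltonian isotopic to $L'\subset\mathbb R^{2n}$ in the ball $B^{2n}(b)$ if there is a Hamiltonian isotopy $\{\Phi_s\}_{s\in[0,1]}$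 of $\mathbb R^{2n}$ such that $\Phi_1(L)=L'$ and $\Phi_s(L)\subset B^{2n}(b)$ for all $s\in[0,1]$. For $\mathbf a=(a_1,\dots,a_n)$ with positive components put $$\underline a=\min_{1\le i\le n}a_i,\qquad m(\mathbf a)=\#\{i\mid a_i=\underline a\},\qquad |\mathbf a|=\sum_{i=1}^n a_i,\qquad \|\mathbf a\|=|\mathbf a|+\underline a,$$ and let $\Gamma(\mathbf a)\subset\mathbb R$ be the subgroup formed by all integer combinations of $a_1-\underline a,\dots,a_n-\underline a$. Write $\mathbf a\simeq\mathbf a'$ if $\underline a=\underline a'$, $m(\mathbf a)=m(\mathbf a')$ and $\Gamma(\mathbf a)=\Gamma(\mathbf a')$. **Theorem.** Let $\mathbf a,\mathbf a'$ be vectors with $n$ positive components. (i) If $\mathbf a$ and $\mathbf a'$ are related by a permutation of the components, then the tori $T(\mathbf a)$ and $T(\mathbf a')$ are Hamiltonian isotopic in the ball $B^{2n}(|\mathbf a|)$. (ii) If $\mathbf a\simeq\mathbf a'$, then the tori $T(\mathbf a)$ and $T(\mathbf a')$ are Hamiltonian isotopic in the ball $B^{2n}\bigl(\max(\|\mathbf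 a\|,\|\mathbf a'\|)\bigr)$. -/

import Mathlib

noncomputable section

open Set
open scoped ContDiff Manifold

namespace ProductTori

/-- The space `ℝ²ⁿ`, with coordinates `(x₁, y₁, …, xₙ, yₙ)`, written as `ℂⁿ` with `z_j = x_j + i y_j`.
It carries the Euclidean norm, and is used as a real normed space only. -/
abbrev Space (n : ℕ) : Type := EuclideanSpace ℂ (Fin n)

/-- The standard symplectic form `∑ dx_j ∧ dy_j`. -/
def stdForm {n : ℕ} (u v : Space n) : ℝ :=
  ∑ j, ((u j).re * (v j).im - (u j).im * (v j).re)

/-- The closed ball `B²ⁿ(b)`, of radius `√(b / π)`, centred at the origin. -/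
def ball (n : ℕ) (b : ℝ) : Set (Space n) :=
  Metric.closedBall 0 √(b / Real.pi)

/-- The product torus `T(a) = T(a₁) × ⋯ × T(aₙ)`, where `T(a_j)` is the boundary of the disc of
area `a_j` (that is, of radius `√(a_j / π)`) in `ℝ²` centred at the origin. -/
def torus {n : ℕ} (a : Fin n → ℝ) : Set (Space n) :=
  {z | ∀ j, z j ∈ Metric.sphere (0 : ℂ) √(a j / Real.pi)}

/-- `Φ` (restricted to times in `[0, 1]`) is a Hamiltonian isotopy: it is the flow, starting at the
identity, of the vector fields `X t` given by `ω (X t, ·) = d(H t)` for a family `H t`, `t ∈ [0, 1]`,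
of functions that is smooth on `[0, 1] × ℝ²ⁿ`, and each `Φ t` is a diffeomorphism of `ℝ²ⁿ`. -/
def IsHamiltonianIsotopy {n : ℕ} (Φ : ℝ → Space n → Space n) : Prop :=
  ∃ (H : ℝ → Space n → ℝ) (X : ℝ → Space n → Space n),
    ContDiffOn ℝ ∞ (fun p : ℝ × Space n => H p.1 p.2) (Icc 0 1 ×ˢ univ) ∧
    (∀ t ∈ Icc (0 : ℝ) 1, ∀ z v, stdForm (X t z) v = fderiv ℝ (H t) z v) ∧
    (∀ z, Φ 0 z = z) ∧
    (∀ z, ∀ t ∈ Icc (0 : ℝ) 1,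
      HasDerivWithinAt (fun s => Φ s z) (X t (Φ t z)) (Icc 0 1) t) ∧
    (∀ t ∈ Icc (0 : ℝ) 1, ∃ g : Space n ≃ₘ[ℝ] Space n, ∀ z, g z = Φ t z)

/-- `L` is Hamiltonian isotopic to `L'` in the ball `B²ⁿ(b)`: the isotopy is one of the whole
of `ℝ²ⁿ`, and it keeps `L` inside the ball at all times. -/
def HamIsotopicInBall {n : ℕ} (b : ℝ) (L L' : Set (Space n)) : Prop :=
  ∃ Φ : ℝ → Space n → Space n,
    IsHamiltonianIsotopy Φ ∧ Φ 1 '' L = L' ∧ ∀ s ∈ Icc (0 : ℝ) 1, Φ s '' L ⊆ ball n b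

/-- The least component of the vector `a` (for `n ≥ 1`). -/
def minComp {n : ℕ} (a : Fin n → ℝ) : ℝ := ⨅ i, a i

/-- `m(a)`, the number of components of `a` that are equal to the least one. -/
def minMult {n : ℕ} (a : Fin n → ℝ) : ℕ := Nat.card {i // a i = minComp a}

/-- `|a|`, the sum of the components of `a`. -/
def total {n : ℕ} (a : Fin n → ℝ) : ℝ := ∑ i, a i

/-- `‖a‖`, the sum of the components of `a` plus the least component. -/
def enlargedTotal {n : ℕ} (a : Fin n → ℝ) : ℝ := total a + minComp a

/-- `Γ(a)`, the group of the integer combinations of the numbers `a_i - min a`. -/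
def excessGroup {n : ℕ} (a : Fin n → ℝ) : AddSubgroup ℝ :=
  AddSubgroup.closure (range fun i => a i - minComp a)

/-- The relation `a ≃ a'`. -/
def Equivalent {n : ℕ} (a a' : Fin n → ℝ) : Prop :=
  minComp a = minComp a' ∧ minMult a = minMult a' ∧ excessGroup a = excessGroup a'

end ProductTori

end

noncomputable section

open Set
open scoped ContDiff Manifold ComplexConjugate

namespace ProductTori

/-! Permutations come from unitary rotations in the complex plane of two coordinates: the quarter
turn swaps two components and preserves the norm, so tori never leave their ball
(`hamIsotopic_perm`).

The second claim needs one more isotopy, the twist (`hamIsotopic_twist`). Where |z_j| > |z_i|,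
divide by the circle action rotating z_i and z_j in opposite directions. Its moment is `gap`, and
with u the phase of z_j, the pair (u z_i, z_k) gives coordinates on the reduced space. A quarter
turn there exchanges |z_i| and |z_k| while |z_j|² - |z_i|² is conserved. So (a_i, a_j, a_k) becomes
(a_k, a_j + a_k - a_i, a_i), and along the way the total grows by at most a_k. If a_i is the
minimum, swapping i and k back adds the excess of a_k over the minimum to the component a_j
(`hamIsotopic_update`).

What remains is algebra on the positive excesses d_l = a_l - min a: pass between two positive tuples
generating the same subgroup of ℝ by adding one entry to another, the inverse of this, and
permutations, without the sum ever exceeding the larger of the two sums (`linked_of_closure_eq`).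
Without the bound this is Nielsen equivalence of generating tuples, that is, the Euclidean
algorithm. To respect the bound, one entry is marked and the others are reduced modulo it into (0,
marked entry] (`wrap`). If the marked entry is the minimum, the sum is at most the number of entries
times the minimum, hence at most the original sum. Nielsen moves fixing the marked entry can be
carried out within this bound (`linked_wrap_of_nielsenEquiv`), and a smaller entry can take over as
the mark (`linked_wrap_wrap`).

To connect two marked entries, both tuples are lifted to bases of a lattice. With at least three
entries, some vector of small positive value completes either marked vector to part of a basis
(`linked_of_three`); with two entries a continued fraction argument serves (`linked_of_two`). -/

/-! ### Hamiltonian isotopies in a ball form a symmetric and transitive relation. -/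

lemma stdForm_add_left {n : ℕ} (u u' v : Space n) :
    stdForm (u + u') v = stdForm u v + stdForm u' v := by
  simp only [stdForm, ← Finset.sum_add_distrib, PiLp.add_apply, Complex.add_re, Complex.add_im]
  exact Finset.sum_congr rfl fun j _ => by ring

lemma stdForm_smul_left {n : ℕ} (r : ℝ) (u v : Space n) :
    stdForm (r • u) v = r * stdForm u v := by
  simp only [stdForm, Finset.mul_sum, PiLp.smul_apply, Complex.real_smul, Complex.mul_re,
    Complex.mul_im, Complex.ofReal_re, Complex.ofReal_im]
  exact Finset.sum_congr rfl fun j _ => by ring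

lemma differentiable_slice {n : ℕ} {H : ℝ → Space n → ℝ}
    (hH : ContDiffOn ℝ ∞ (fun p : ℝ × Space n => H p.1 p.2) (Icc 0 1 ×ˢ univ))
    {t : ℝ} (ht : t ∈ Icc (0 : ℝ) 1) : Differentiable ℝ (H t) := by
  have h : ContDiffOn ℝ ∞ (fun z : Space n => H t z) univ :=
    hH.comp (t := Icc 0 1 ×ˢ univ) (f := fun z : Space n => (t, z))
      (by fun_prop) (fun z _ => ⟨ht, mem_univ _⟩)
  exact (contDiffOn_univ.1 h).differentiable (by simp)

/-- The flow of an autonomous Hamiltonian is a Hamiltonian isotopy. -/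
lemma IsHamiltonianIsotopy.of_flow {n : ℕ} {Φ : ℝ → Space n → Space n} (H : Space n → ℝ)
    (X : Space n → Space n) (hH : ContDiff ℝ ∞ H)
    (hX : ∀ z v, stdForm (X z) v = fderiv ℝ H z v) (h0 : ∀ z, Φ 0 z = z)
    (hd : ∀ z t, HasDerivAt (fun s => Φ s z) (X (Φ t z)) t)
    (hs : ∀ t, ContDiff ℝ ∞ (Φ t)) (hinv : ∀ t z, Φ (-t) (Φ t z) = z) :
    IsHamiltonianIsotopy Φ := by
  refine ⟨fun _ => H, fun _ => X, (hH.comp contDiff_snd).contDiffOn, fun _ _ => hX, h0,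
    fun z t _ => (hd z t).hasDerivWithinAt, fun t _ => ?_⟩
  exact ⟨⟨⟨Φ t, Φ (-t), hinv t, fun z => by simpa using hinv (-t) z⟩, (hs t).contMDiff,
    (hs (-t)).contMDiff⟩, fun _ => rfl⟩

lemma HamIsotopicInBall.refl {n : ℕ} {b : ℝ} {L : Set (Space n)} (hL : L ⊆ ball n b) :
    HamIsotopicInBall b L L := by
  refine ⟨fun _ z => z, IsHamiltonianIsotopy.of_flow (fun _ => 0) (fun _ => 0) contDiff_const
    (fun z v => by simp [stdForm]) (fun _ => rfl) (fun z t => hasDerivAt_const t z)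
    (fun _ => contDiff_id) fun _ _ => rfl, by simp, by simpa using fun _ _ _ => hL⟩

/-- Time is reversed; precomposing with the inverse of the time-one map makes the reversed path
start at the identity. -/
lemma HamIsotopicInBall.symm {n : ℕ} {b : ℝ} {L L' : Set (Space n)}
    (h : HamIsotopicInBall b L L') : HamIsotopicInBall b L' L := by
  obtain ⟨Φ, ⟨H, X, hH, hX, h0, hd, hg⟩, himg, hball⟩ := h
  obtain ⟨g, hg1⟩ := hg 1 (by simp)
  have hrev : ∀ t ∈ Icc (0 : ℝ) 1, 1 - t ∈ Icc (0 : ℝ) 1 := fun t ht =>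
    ⟨by linarith [ht.2], by linarith [ht.1]⟩
  have himg' : ∀ s, (fun z => Φ (1 - s) (g.symm z)) '' L' = Φ (1 - s) '' L := by
    intro s
    rw [← himg, image_image]
    exact image_congr fun z _ => by rw [← hg1, g.symm_apply_apply]
  refine ⟨fun s z => Φ (1 - s) (g.symm z), ⟨fun t z => -H (1 - t) z, fun t z => -X (1 - t) z,
    ?_, ?_, ?_, ?_, ?_⟩, ?_, ?_⟩
  · exact (hH.comp (t := Icc 0 1 ×ˢ univ) (f := fun p : ℝ × Space n => (1 - p.1, p.2))
      (by fun_prop) (fun p hp => ⟨hrev _ hp.1, mem_univ _⟩)).neg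
  · intro t ht z v
    change stdForm (-X (1 - t) z) v = fderiv ℝ (fun z => -H (1 - t) z) z v
    rw [show -X (1 - t) z = (-1 : ℝ) • X (1 - t) z by simp, stdForm_smul_left, hX _ (hrev t ht),
      fderiv_fun_neg]
    simp
  · intro z
    simp [← hg1]
  · intro z t ht
    have h := (hd (g.symm z) (1 - t) (hrev t ht)).scomp t
      (((hasDerivAt_id t).const_sub 1).hasDerivWithinAt (s := Icc 0 1)) (fun s hs => hrev s hs)
    simpa [Function.comp_def] using h
  · intro t ht
    obtain ⟨f, hf⟩ := hg (1 - t) (hrev t ht)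
    exact ⟨g.symm.trans f, fun z => by simp [hf]⟩
  · rw [himg']
    simp [h0]
  · intro s hs
    rw [himg']
    exact hball _ (hrev s hs)

lemma HamIsotopicInBall.trans {n : ℕ} {b : ℝ} {L L' L'' : Set (Space n)}
    (h : HamIsotopicInBall b L L') (h' : HamIsotopicInBall b L' L'') :
    HamIsotopicInBall b L L'' := by
  obtain ⟨Φ, ⟨H, X, hH, hX, h0, hd, hg⟩, himg, hball⟩ := h
  obtain ⟨Ψ, ⟨K, Y, hK, hY, h0', hd', hg'⟩, himg', hball'⟩ := h'
  -- The first isotopy runs during [0, 1/3] and the second during [2/3, 1]. Both rest in between,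
  -- which makes the concatenated Hamiltonian smooth in time.
  set α : ℝ → ℝ := fun t => Real.smoothTransition (3 * t) with hα
  set β : ℝ → ℝ := fun t => Real.smoothTransition (3 * t - 2) with hβ
  have hαs : ContDiff ℝ ∞ α := Real.smoothTransition.contDiff.comp (by fun_prop)
  have hβs : ContDiff ℝ ∞ β := Real.smoothTransition.contDiff.comp (by fun_prop)
  have hαI : ∀ t, α t ∈ Icc (0 : ℝ) 1 := fun t =>
    ⟨Real.smoothTransition.nonneg _, Real.smoothTransition.le_one _⟩
  have hβI : ∀ t, β t ∈ Icc (0 : ℝ) 1 := fun t =>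
    ⟨Real.smoothTransition.nonneg _, Real.smoothTransition.le_one _⟩
  have hα1 : ∀ t, 1 / 3 ≤ t → α t = 1 := fun t ht =>
    Real.smoothTransition.one_of_one_le (by linarith)
  have hβ0 : ∀ t, t ≤ 2 / 3 → β t = 0 := fun t ht =>
    Real.smoothTransition.zero_of_nonpos (by linarith)
  have hαd : ∀ t, HasDerivAt α (deriv α t) t := fun t =>
    (hαs.differentiable (by simp) t).hasDerivAt
  have hβd : ∀ t, HasDerivAt β (deriv β t) t := fun t =>
    (hβs.differentiable (by simp) t).hasDerivAt
  have hα's : ContDiff ℝ ∞ (deriv α) := ((contDiff_infty_iff_deriv).1 hαs).2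
  have hβ's : ContDiff ℝ ∞ (deriv β) := ((contDiff_infty_iff_deriv).1 hβs).2
  have hα'0 : ∀ t, 1 / 3 < t → deriv α t = 0 := fun t ht => by
    have : α =ᶠ[nhds t] fun _ => 1 := by
      filter_upwards [lt_mem_nhds ht] with s hs using hα1 s hs.le
    simpa using this.deriv_eq
  have hβ'0 : ∀ t, t < 2 / 3 → deriv β t = 0 := fun t ht => by
    have : β =ᶠ[nhds t] fun _ => 0 := by
      filter_upwards [gt_mem_nhds ht] with s hs using hβ0 s hs.le
    simpa using this.deriv_eq
  refine ⟨fun t z => Ψ (β t) (Φ (α t) z),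
    ⟨fun t z => deriv α t * H (α t) z + deriv β t * K (β t) z,
      fun t z => deriv α t • X (α t) z + deriv β t • Y (β t) z, ?_, ?_, ?_, ?_, ?_⟩, ?_, ?_⟩
  · refine ContDiffOn.add (ContDiffOn.mul ?_ ?_) (ContDiffOn.mul ?_ ?_)
    · exact (hα's.comp contDiff_fst).contDiffOn
    · exact hH.comp (f := fun p : ℝ × Space n => (α p.1, p.2))
        ((hαs.comp contDiff_fst).prodMk contDiff_snd).contDiffOn
        (fun p _ => ⟨hαI _, mem_univ _⟩)
    · exact (hβ's.comp contDiff_fst).contDiffOn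
    · exact hK.comp (f := fun p : ℝ × Space n => (β p.1, p.2))
        ((hβs.comp contDiff_fst).prodMk contDiff_snd).contDiffOn
        (fun p _ => ⟨hβI _, mem_univ _⟩)
  · intro t _ z v
    have e1 := differentiable_slice hH (hαI t) z
    have e2 := differentiable_slice hK (hβI t) z
    rw [stdForm_add_left, stdForm_smul_left, stdForm_smul_left, hX _ (hαI t), hY _ (hβI t),
      fderiv_fun_add (e1.const_mul _) (e2.const_mul _), fderiv_const_mul e1, fderiv_const_mul e2]
    simp
  · intro z
    have e : α 0 = 0 := Real.smoothTransition.zero_of_nonpos (by simp)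
    simp [e, hβ0 0 (by norm_num), h0, h0']
  · intro z t _
    rcases lt_or_ge t (2 / 3) with ht | ht
    · have h1 : HasDerivWithinAt (fun s => Φ (α s) z) (deriv α t • X (α t) (Φ (α t) z))
          (Icc 0 1) t :=
        (hd z (α t) (hαI t)).scomp t (hαd t).hasDerivWithinAt (fun s _ => hαI s)
      simp only [hβ'0 t ht, hβ0 t ht.le, h0', zero_smul, add_zero]
      refine h1.congr_of_eventuallyEq ?_ (by simp [hβ0 t ht.le, h0'])
      filter_upwards [mem_nhdsWithin_of_mem_nhds (gt_mem_nhds ht)] with s hs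
      simp [hβ0 s hs.le, h0']
    · have ht' : 1 / 3 < t := by linarith
      have h1 : HasDerivWithinAt (fun s => Ψ (β s) (Φ 1 z))
          (deriv β t • Y (β t) (Ψ (β t) (Φ 1 z))) (Icc 0 1) t :=
        (hd' (Φ 1 z) (β t) (hβI t)).scomp t (hβd t).hasDerivWithinAt (fun s _ => hβI s)
      simp only [hα'0 t ht', hα1 t ht'.le, zero_smul, zero_add]
      refine h1.congr_of_eventuallyEq ?_ (by simp [hα1 t ht'.le])
      filter_upwards [mem_nhdsWithin_of_mem_nhds (lt_mem_nhds ht')] with s hs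
      simp [hα1 s hs.le]
  · intro t _
    obtain ⟨f, hf⟩ := hg (α t) (hαI t)
    obtain ⟨f', hf'⟩ := hg' (β t) (hβI t)
    exact ⟨f.trans f', fun z => by simp [hf, hf']⟩
  · have e : β 1 = 1 := Real.smoothTransition.one_of_one_le (by norm_num)
    simp only [e, hα1 1 (by norm_num)]
    rw [← himg', ← himg, image_image]
  · intro t _
    rw [← image_image (Ψ (β t)) (Φ (α t))]
    rcases le_total t (2 / 3) with ht | ht
    · have e : Ψ 0 = id := funext h0'
      rw [hβ0 t ht, e, image_id]
      exact hball _ (hαI t)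
    · rw [hα1 t (by linarith), himg]
      exact hball' _ (hβI t)

/-! ### Tori, balls, and permutations of the components by rotations. -/

lemma hasDerivAt_space {n : ℕ} {f : ℝ → Space n} {f' : Space n} {t : ℝ}
    (h : ∀ l, HasDerivAt (fun s => f s l) (f' l) t) : HasDerivAt f f' t := by
  have := (PiLp.hasFDerivAt_toLp (𝕜 := ℝ) (E := fun _ : Fin n => ℂ) 2
    (fun l => f t l)).comp_hasDerivAt t (hasDerivAt_pi.2 h)
  exact this

lemma fderiv_eq_of_hasDerivAt_line {n : ℕ} {H : Space n → ℝ} {z v : Space n} {d : ℝ}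
    (hH : DifferentiableAt ℝ H z) (h : HasDerivAt (fun s : ℝ => H (z + s • v)) d 0) :
    fderiv ℝ H z v = d := by
  rw [← hH.lineDeriv_eq_fderiv]
  exact HasLineDerivAt.lineDeriv h

lemma mem_torus_iff {n : ℕ} {a : Fin n → ℝ} {z : Space n} :
    z ∈ torus a ↔ ∀ j, ‖z j‖ = √(a j / Real.pi) := by
  simp [torus]

lemma mem_ball_of_sum_le {n : ℕ} {b : ℝ} {z : Space n} (h : ∑ l, ‖z l‖ ^ 2 ≤ b / Real.pi) :
    z ∈ ball n b := by
  rw [ball, mem_closedBall_zero_iff, EuclideanSpace.norm_eq]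
  exact Real.sqrt_le_sqrt h

lemma sum_norm_sq_of_mem_torus {n : ℕ} {a : Fin n → ℝ} (ha : ∀ i, 0 < a i) {z : Space n}
    (hz : z ∈ torus a) : ∑ l, ‖z l‖ ^ 2 = total a / Real.pi := by
  rw [total, Finset.sum_div]
  refine Finset.sum_congr rfl fun l _ => ?_
  rw [mem_torus_iff.1 hz l, Real.sq_sqrt (div_nonneg (ha l).le Real.pi_pos.le)]

lemma torus_subset_ball {n : ℕ} {a : Fin n → ℝ} (ha : ∀ i, 0 < a i) {b : ℝ} (hb : total a ≤ b) :
    torus a ⊆ ball n b := by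
  intro z hz
  refine mem_ball_of_sum_le ?_
  rw [sum_norm_sq_of_mem_torus ha hz]
  gcongr

lemma sum_eq_add_of_off {n : ℕ} {i k : Fin n} (hik : i ≠ k) (f : Fin n → ℝ)
    (h : ∀ l, l ≠ i → l ≠ k → f l = 0) : ∑ l, f l = f i + f k :=
  Finset.sum_eq_add i k hik (fun l _ hl => h l hl.1 hl.2) (by simp) (by simp)

/-- The rotation by the angle `π t / 2` in the complex plane of the coordinates `i`, `k`. -/
def planeRotation {n : ℕ} (i k : Fin n) (t : ℝ) (z : Space n) : Space n :=
  WithLp.toLp 2 fun l =>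
    if l = i then (Real.cos (Real.pi / 2 * t) : ℂ) * z i - (Real.sin (Real.pi / 2 * t) : ℂ) * z k
    else if l = k then
      (Real.sin (Real.pi / 2 * t) : ℂ) * z i + (Real.cos (Real.pi / 2 * t) : ℂ) * z k
    else z l

lemma isHamiltonianIsotopy_planeRotation {n : ℕ} {i k : Fin n} (hik : i ≠ k) :
    IsHamiltonianIsotopy (planeRotation i k) := by
  have hH : ContDiff ℝ ∞ (fun z : Space n =>
      Real.pi / 2 * ((z i).re * (z k).im - (z i).im * (z k).re)) := by
    have hre : ∀ l : Fin n, ContDiff ℝ ∞ fun z : Space n => (z l).re := fun l =>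
      Complex.reCLM.contDiff.comp (contDiff_piLp_apply 2)
    have him : ∀ l : Fin n, ContDiff ℝ ∞ fun z : Space n => (z l).im := fun l =>
      Complex.imCLM.contDiff.comp (contDiff_piLp_apply 2)
    exact contDiff_const.mul (((hre i).mul (him k)).sub ((him i).mul (hre k)))
  refine IsHamiltonianIsotopy.of_flow _
    (fun z => WithLp.toLp 2 fun l =>
      if l = i then -((Real.pi / 2 : ℝ) : ℂ) * z k
      else if l = k then ((Real.pi / 2 : ℝ) : ℂ) * z i else 0) hH ?_ ?_ ?_ ?_ ?_
  · intro z v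
    rw [stdForm, sum_eq_add_of_off hik]
    · symm
      refine fderiv_eq_of_hasDerivAt_line (hH.differentiable (by simp) z) ?_
      have hl : ∀ p q : ℝ, HasDerivAt (fun s : ℝ => p + s * q) q 0 := fun p q => by
        simpa using ((hasDerivAt_id (0 : ℝ)).mul_const q).const_add p
      have := ((((hl (z i).re (v i).re).mul (hl (z k).im (v k).im)).sub
        ((hl (z i).im (v i).im).mul (hl (z k).re (v k).re))).const_mul (Real.pi / 2))
      simp only [PiLp.add_apply, PiLp.smul_apply, Complex.real_smul, Complex.add_re,
        Complex.add_im, Complex.re_ofReal_mul, Complex.im_ofReal_mul]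
      refine this.congr_deriv ?_
      simp [hik.symm]
      ring
    · intro l hl hl'
      simp [hl, hl']
  · intro z
    ext l
    simp only [planeRotation]
    split_ifs with h1 h2
    · simp [h1]
    · simp [h2]
    · simp
  · intro z t
    have hc : HasDerivAt (fun s : ℝ => ((Real.cos (Real.pi / 2 * s) : ℝ) : ℂ))
        ((-Real.sin (Real.pi / 2 * t) * (Real.pi / 2) : ℝ) : ℂ) t := by
      have := ((hasDerivAt_id t).const_mul (Real.pi / 2)).cos.ofReal_comp
      simpa using this
    have hs : HasDerivAt (fun s : ℝ => ((Real.sin (Real.pi / 2 * s) : ℝ) : ℂ))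
        ((Real.cos (Real.pi / 2 * t) * (Real.pi / 2) : ℝ) : ℂ) t := by
      have := ((hasDerivAt_id t).const_mul (Real.pi / 2)).sin.ofReal_comp
      simpa using this
    refine hasDerivAt_space fun l => ?_
    simp only [planeRotation, if_true, if_neg hik.symm]
    split_ifs with h1 h2
    · refine ((hc.mul_const (z i)).sub (hs.mul_const (z k))).congr_deriv ?_
      push_cast; ring
    · refine ((hs.mul_const (z i)).add (hc.mul_const (z k))).congr_deriv ?_
      push_cast; ring
    · exact hasDerivAt_const _ _
  · intro t
    have hp : ∀ l : Fin n, ContDiff ℝ ∞ fun z : Space n => z l := fun l =>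
      contDiff_piLp_apply 2
    refine (contDiff_piLp 2).2 fun l => ?_
    simp only [planeRotation]
    split_ifs
    · exact (contDiff_const.mul (hp i)).sub (contDiff_const.mul (hp k))
    · exact (contDiff_const.mul (hp i)).add (contDiff_const.mul (hp k))
    · exact hp l
  · intro t z
    have h : ((Real.sin (Real.pi / 2 * t) : ℝ) : ℂ) ^ 2 + (Real.cos (Real.pi / 2 * t) : ℝ) ^ 2
        = 1 := by exact_mod_cast Real.sin_sq_add_cos_sq (Real.pi / 2 * t)
    ext l
    simp only [planeRotation, if_true, if_neg hik.symm, mul_neg, Real.cos_neg, Real.sin_neg]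
    split_ifs with h1 h2
    · subst h1; push_cast at h ⊢; linear_combination (z l) * h
    · subst h2; push_cast at h ⊢; linear_combination (z l) * h
    · rfl

lemma sum_norm_sq_planeRotation {n : ℕ} {i k : Fin n} (hik : i ≠ k) (t : ℝ) (z : Space n) :
    ∑ l, ‖planeRotation i k t z l‖ ^ 2 = ∑ l, ‖z l‖ ^ 2 := by
  rw [← sub_eq_zero, ← Finset.sum_sub_distrib, sum_eq_add_of_off hik]
  · simp only [planeRotation, if_true, if_neg hik.symm, Complex.sq_norm, Complex.normSq_apply,
      Complex.add_re, Complex.add_im, Complex.sub_re, Complex.sub_im, Complex.re_ofReal_mul,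
      Complex.im_ofReal_mul]
    linear_combination ((z i).re ^ 2 + (z i).im ^ 2 + (z k).re ^ 2 + (z k).im ^ 2) *
      Real.sin_sq_add_cos_sq (Real.pi / 2 * t)
  · intro l h1 h2
    simp [planeRotation, h1, h2]

lemma hamIsotopic_swap {n : ℕ} {a : Fin n → ℝ} (ha : ∀ i, 0 < a i) (i k : Fin n) {b : ℝ}
    (hb : total a ≤ b) :
    HamIsotopicInBall b (torus a) (torus fun l => a (Equiv.swap i k l)) := by
  rcases eq_or_ne i k with rfl | hik
  · simpa using HamIsotopicInBall.refl (torus_subset_ball ha hb)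
  refine ⟨planeRotation i k, isHamiltonianIsotopy_planeRotation hik, ?_, ?_⟩
  · have h1 : ∀ z : Space n, planeRotation i k 1 z i = -z k := fun z => by simp [planeRotation]
    have h2 : ∀ z : Space n, planeRotation i k 1 z k = z i := fun z => by
      simp [planeRotation, hik.symm]
    have h3 : ∀ (z : Space n) l, l ≠ i → l ≠ k → planeRotation i k 1 z l = z l :=
      fun z l hl hl' => by simp [planeRotation, hl, hl']
    ext w
    constructor
    · rintro ⟨z, hz, rfl⟩
      rw [mem_torus_iff] at hz ⊢
      intro l
      rcases eq_or_ne l i with rfl | hl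
      · simp [h1, hz]
      rcases eq_or_ne l k with rfl | hl'
      · simp [h2, hz]
      · simp [h3 z l hl hl', hz, Equiv.swap_apply_of_ne_of_ne hl hl']
    · intro hw
      rw [mem_torus_iff] at hw
      -- The quarter turn sends (z_i, z_k) to (-z_k, z_i); this is the preimage of `w`.
      refine ⟨WithLp.toLp 2 fun l => if l = i then w k else if l = k then -w i else w l, ?_, ?_⟩
      · rw [mem_torus_iff]
        intro l
        rcases eq_or_ne l i with rfl | hl
        · simp [hw]
        rcases eq_or_ne l k with rfl | hl'
        · simp [hw, hl]
        · simp [hl, hl', hw, Equiv.swap_apply_of_ne_of_ne hl hl']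
      · ext l
        rcases eq_or_ne l i with rfl | hl
        · rw [h1]; simp [hik.symm]
        rcases eq_or_ne l k with rfl | hl'
        · rw [h2]; simp
        · rw [h3 _ l hl hl']; simp [hl, hl']
  · rintro s - _ ⟨z, hz, rfl⟩
    refine mem_ball_of_sum_le ?_
    rw [sum_norm_sq_planeRotation hik, sum_norm_sq_of_mem_torus ha hz]
    gcongr

lemma hamIsotopic_perm {n : ℕ} {a : Fin n → ℝ} (ha : ∀ i, 0 < a i) (σ : Equiv.Perm (Fin n))
    {b : ℝ} (hb : total a ≤ b) :
    HamIsotopicInBall b (torus a) (torus fun l => a (σ l)) := by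
  induction σ using Equiv.Perm.swap_induction_on' with
  | one => exact HamIsotopicInBall.refl (torus_subset_ball ha hb)
  | mul_swap f x y _ ih =>
    refine ih.trans ?_
    have h : total (fun l => a (f l)) ≤ b := by
      rwa [total, Equiv.sum_comp f a]
    exact hamIsotopic_swap (fun l => ha (f l)) x y h

/-! ### The twist of three complex coordinates. -/

/-- The moment `|q|² - |p|²` of the circle action rotating `p` and `q` in opposite directions. -/
def gap (p q : ℂ) : ℝ := Complex.normSq q - Complex.normSq p

/-- The product `unitPhase q * p` is invariant under opposite rotations of `p` and `q`, so it
descends to the reduced space. At `q = 0` the phase is 0, and `unitPhase_mul_norm` still holds. -/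
def unitPhase (q : ℂ) : ℂ := q / (‖q‖ : ℂ)

/-- The generator of the rotation of `p` and `r`, twisted by the phase of `q`. -/
def twistMoment (p q r : ℂ) : ℝ := (conj (unitPhase q * p) * r).im

/-- With u the phase of `q`, the pair (u p, r) is rotated by the angle `τ`, and `p`, `q` are
moreover rotated by `-θ` and `θ`. The new modulus of `q` is the one that conserves `gap`. -/
def twistFst (τ θ : ℝ) (p q r : ℂ) : ℂ :=
  Complex.exp (-(θ * Complex.I)) * (Real.cos τ * p - Real.sin τ * (conj (unitPhase q) * r))

def twistThd (τ : ℝ) (p q r : ℂ) : ℂ := Real.sin τ * (unitPhase q * p) + Real.cos τ * r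

def twistSnd (τ θ : ℝ) (p q r : ℂ) : ℂ :=
  Complex.exp (θ * Complex.I) * unitPhase q *
    (√(gap p q + Complex.normSq (twistFst τ θ p q r)) : ℝ)

lemma normSq_unitPhase {q : ℂ} (hq : q ≠ 0) : Complex.normSq (unitPhase q) = 1 := by
  rw [unitPhase, Complex.normSq_div, Complex.normSq_ofReal, Complex.normSq_eq_norm_sq, sq,
    div_self]
  simpa using hq

lemma unitPhase_mul_conj {q : ℂ} (hq : q ≠ 0) : unitPhase q * conj (unitPhase q) = 1 := by
  rw [Complex.mul_conj, normSq_unitPhase hq, Complex.ofReal_one]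

lemma unitPhase_mul_norm (q : ℂ) : unitPhase q * (‖q‖ : ℂ) = q := by
  rcases eq_or_ne q 0 with rfl | hq
  · simp
  · rw [unitPhase, div_mul_cancel₀]
    simpa using hq

lemma ne_zero_of_gap_pos {p q : ℂ} (h : 0 < gap p q) : q ≠ 0 := by
  rintro rfl
  have := Complex.normSq_nonneg p
  simp [gap] at h
  linarith

lemma gap_add_normSq_pos {p q : ℂ} (h : 0 < gap p q) (w : ℂ) : 0 < gap p q + Complex.normSq w :=
  add_pos_of_pos_of_nonneg h (Complex.normSq_nonneg _)

lemma exp_mul_exp_neg (θ : ℝ) :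
    Complex.exp (θ * Complex.I) * Complex.exp (-(θ * Complex.I)) = 1 := by
  rw [← Complex.exp_add, add_neg_cancel, Complex.exp_zero]

lemma normSq_exp (θ : ℝ) : Complex.normSq (Complex.exp (θ * Complex.I)) = 1 := by
  rw [Complex.normSq_eq_norm_sq, Complex.norm_exp_ofReal_mul_I, one_pow]

lemma normSq_exp_neg (θ : ℝ) : Complex.normSq (Complex.exp (-(θ * Complex.I))) = 1 := by
  have := normSq_exp (-θ)
  rwa [Complex.ofReal_neg, neg_mul] at this

lemma conj_exp (θ : ℝ) :
    conj (Complex.exp (θ * Complex.I)) = Complex.exp (-(θ * Complex.I)) := by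
  rw [← Complex.exp_conj]
  simp

lemma unitPhase_mul_conj_mul {q : ℂ} (hq : q ≠ 0) (c s : ℝ) (p r : ℂ) :
    unitPhase q * (c * p - s * (conj (unitPhase q) * r)) = c * (unitPhase q * p) - s * r := by
  linear_combination (-s * r) * unitPhase_mul_conj hq

lemma normSq_twistFst {q : ℂ} (hq : q ≠ 0) (τ θ : ℝ) (p r : ℂ) :
    Complex.normSq (twistFst τ θ p q r)
      = Complex.normSq (Real.cos τ * (unitPhase q * p) - Real.sin τ * r) := by
  rw [← unitPhase_mul_conj_mul hq, Complex.normSq_mul, normSq_unitPhase hq, twistFst,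
    Complex.normSq_mul, normSq_exp_neg]

lemma normSq_twistFst_add_twistThd {q : ℂ} (hq : q ≠ 0) (τ θ : ℝ) (p r : ℂ) :
    Complex.normSq (twistFst τ θ p q r) + Complex.normSq (twistThd τ p q r)
      = Complex.normSq p + Complex.normSq r := by
  have h : Complex.normSq p = Complex.normSq (unitPhase q * p) := by
    rw [Complex.normSq_mul, normSq_unitPhase hq, one_mul]
  rw [normSq_twistFst hq, twistThd, h]
  generalize unitPhase q * p = P
  simp only [Complex.normSq_apply, Complex.add_re, Complex.add_im, Complex.sub_re, Complex.sub_im,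
    Complex.re_ofReal_mul, Complex.im_ofReal_mul]
  linear_combination (P.re ^ 2 + P.im ^ 2 + r.re ^ 2 + r.im ^ 2) * Real.sin_sq_add_cos_sq τ

lemma norm_twistSnd {p q : ℂ} (h : 0 < gap p q) (τ θ : ℝ) (r : ℂ) :
    ‖twistSnd τ θ p q r‖ = √(gap p q + Complex.normSq (twistFst τ θ p q r)) := by
  have h1 : ‖unitPhase q‖ = 1 := by
    have := normSq_unitPhase (ne_zero_of_gap_pos h)
    rw [Complex.normSq_eq_norm_sq] at this
    exact (pow_eq_one_iff_of_nonneg (norm_nonneg _) two_ne_zero).1 this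
  rw [twistSnd, norm_mul, norm_mul, h1, Complex.norm_exp_ofReal_mul_I, Complex.norm_real,
    Real.norm_of_nonneg (Real.sqrt_nonneg _), one_mul, one_mul]

lemma normSq_twistSnd {p q : ℂ} (h : 0 < gap p q) (τ θ : ℝ) (r : ℂ) :
    Complex.normSq (twistSnd τ θ p q r) = gap p q + Complex.normSq (twistFst τ θ p q r) := by
  rw [Complex.normSq_eq_norm_sq, norm_twistSnd h, Real.sq_sqrt (gap_add_normSq_pos h _).le]

lemma gap_twist {p q : ℂ} (h : 0 < gap p q) (τ θ : ℝ) (r : ℂ) :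
    gap (twistFst τ θ p q r) (twistSnd τ θ p q r) = gap p q := by
  rw [gap, normSq_twistSnd h, add_sub_cancel_right]

lemma unitPhase_twistSnd {p q : ℂ} (h : 0 < gap p q) (τ θ : ℝ) (r : ℂ) :
    unitPhase (twistSnd τ θ p q r) = Complex.exp (θ * Complex.I) * unitPhase q := by
  rw [unitPhase, norm_twistSnd h, twistSnd, mul_div_cancel_right₀]
  exact_mod_cast (Real.sqrt_pos.2 (gap_add_normSq_pos h _)).ne'

lemma unitPhase_twistSnd_mul {p q : ℂ} (h : 0 < gap p q) (τ θ : ℝ) (r : ℂ) :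
    unitPhase (twistSnd τ θ p q r) * twistFst τ θ p q r
      = Real.cos τ * (unitPhase q * p) - Real.sin τ * r := by
  rw [unitPhase_twistSnd h, twistFst, ← unitPhase_mul_conj_mul (ne_zero_of_gap_pos h)]
  linear_combination (unitPhase q * (Real.cos τ * p - Real.sin τ * (conj (unitPhase q) * r))) *
    exp_mul_exp_neg θ

lemma twistMoment_twist {p q : ℂ} (h : 0 < gap p q) (τ θ : ℝ) (r : ℂ) :
    twistMoment (twistFst τ θ p q r) (twistSnd τ θ p q r) (twistThd τ p q r)
      = twistMoment p q r := by
  rw [twistMoment, unitPhase_twistSnd_mul h, twistMoment, twistThd]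
  generalize unitPhase q * p = P
  simp only [Complex.mul_im, Complex.add_re, Complex.add_im, Complex.sub_re, Complex.sub_im,
    Complex.mul_re, Complex.ofReal_re, Complex.ofReal_im, Complex.conj_re, Complex.conj_im]
  linear_combination (P.re * r.im - P.im * r.re) * Real.sin_sq_add_cos_sq τ

lemma twistThd_neg_twist {p q : ℂ} (h : 0 < gap p q) (τ θ : ℝ) (r : ℂ) :
    twistThd (-τ) (twistFst τ θ p q r) (twistSnd τ θ p q r) (twistThd τ p q r) = r := by
  have e : ((Real.sin τ : ℝ) : ℂ) ^ 2 + (Real.cos τ : ℝ) ^ 2 = 1 := by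
    exact_mod_cast Real.sin_sq_add_cos_sq τ
  rw [twistThd, unitPhase_twistSnd_mul h, twistThd, Real.sin_neg, Real.cos_neg]
  push_cast at e ⊢
  linear_combination r * e

lemma twistFst_neg_twist {p q : ℂ} (h : 0 < gap p q) (τ θ : ℝ) (r : ℂ) :
    twistFst (-τ) (-θ) (twistFst τ θ p q r) (twistSnd τ θ p q r) (twistThd τ p q r) = p := by
  have e : ((Real.sin τ : ℝ) : ℂ) ^ 2 + (Real.cos τ : ℝ) ^ 2 = 1 := by
    exact_mod_cast Real.sin_sq_add_cos_sq τ
  have e1 := exp_mul_exp_neg θ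
  have e2 := unitPhase_mul_conj (ne_zero_of_gap_pos h)
  rw [twistFst, unitPhase_twistSnd h, twistFst, twistThd, Real.sin_neg, Real.cos_neg, map_mul,
    conj_exp, Complex.ofReal_neg, neg_mul, neg_neg]
  generalize Complex.exp (θ * Complex.I) = E at *
  generalize Complex.exp (-(θ * Complex.I)) = E' at *
  generalize unitPhase q = u at *
  generalize conj u = u' at *
  push_cast at e ⊢
  generalize Complex.sin τ = s at *
  generalize Complex.cos τ = c at *
  linear_combination p * e + (c * (c * p - s * (u' * r)) + s * u' * (s * (u * p) + c * r)) * e1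
    + s ^ 2 * p * e2

lemma twistSnd_neg_twist {p q : ℂ} (h : 0 < gap p q) (τ θ : ℝ) (r : ℂ) :
    twistSnd (-τ) (-θ) (twistFst τ θ p q r) (twistSnd τ θ p q r) (twistThd τ p q r) = q := by
  rw [twistSnd, twistFst_neg_twist h, gap_twist h, unitPhase_twistSnd h, gap, sub_add_cancel,
    ← Complex.norm_def, ← mul_assoc, ← Complex.exp_add]
  simpa using unitPhase_mul_norm q

lemma twistFst_zero (p q r : ℂ) : twistFst 0 0 p q r = p := by simp [twistFst]

lemma twistThd_zero (p q r : ℂ) : twistThd 0 p q r = r := by simp [twistThd]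

lemma twistSnd_zero (p q r : ℂ) : twistSnd 0 0 p q r = q := by
  rw [twistSnd, twistFst_zero, gap, sub_add_cancel, ← Complex.norm_def]
  simpa using unitPhase_mul_norm q

lemma hasDerivAt_normSq {f : ℝ → ℂ} {f' : ℂ} {t : ℝ} (h : HasDerivAt f f' t) :
    HasDerivAt (fun s => Complex.normSq (f s)) (2 * (conj (f t) * f').re) t := by
  have h1 := Complex.reCLM.hasFDerivAt.comp_hasDerivAt t h
  have h2 := Complex.imCLM.hasFDerivAt.comp_hasDerivAt t h
  refine ((h1.mul h1).add (h2.mul h2)).congr_deriv ?_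
  simp
  ring

section time

variable (l m : ℝ) (p q r : ℂ) (t : ℝ)

lemma hasDerivAt_exp_mul_I : HasDerivAt (fun s : ℝ => Complex.exp (((s * m : ℝ) : ℂ) * Complex.I))
    (m * Complex.I * Complex.exp (((t * m : ℝ) : ℂ) * Complex.I)) t := by
  have h : HasDerivAt (fun s : ℝ => ((s * m : ℝ) : ℂ) * Complex.I) (m * Complex.I) t := by
    simpa using ((hasDerivAt_id t).mul_const m).ofReal_comp.mul_const Complex.I
  refine h.cexp.congr_deriv ?_
  ring

/-- The term with `unitPhase q * conj (unitPhase q) - 1` vanishes for `q ≠ 0`; it makes the formula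
valid at `q = 0` too. -/
lemma hasDerivAt_twistFst : HasDerivAt (fun s : ℝ => twistFst (s * l) (s * m) p q r)
    (-(m * Complex.I) * twistFst (t * l) (t * m) p q r - l *
      (Complex.exp (-(((t * m : ℝ) : ℂ) * Complex.I)) * conj (unitPhase q) *
        twistThd (t * l) p q r - Complex.exp (-(((t * m : ℝ) : ℂ) * Complex.I)) *
        (unitPhase q * conj (unitPhase q) - 1) * Real.sin (t * l) * p)) t := by
  have he : HasDerivAt (fun s : ℝ => Complex.exp (-(((s * m : ℝ) : ℂ) * Complex.I)))
      (-m * Complex.I * Complex.exp (-(((t * m : ℝ) : ℂ) * Complex.I))) t := by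
    simpa using hasDerivAt_exp_mul_I (-m) t
  have hc := ((hasDerivAt_id t).mul_const l).cos.ofReal_comp
  have hs := ((hasDerivAt_id t).mul_const l).sin.ofReal_comp
  refine (he.mul ((hc.mul_const p).sub (hs.mul_const (conj (unitPhase q) * r)))).congr_deriv ?_
  simp only [twistFst, twistThd, id, Pi.sub_apply]
  push_cast
  ring

lemma hasDerivAt_twistThd : HasDerivAt (fun s : ℝ => twistThd (s * l) p q r)
    (l * (Real.cos (t * l) * (unitPhase q * p) - Real.sin (t * l) * r)) t := by
  have hc := ((hasDerivAt_id t).mul_const l).cos.ofReal_comp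
  have hs := ((hasDerivAt_id t).mul_const l).sin.ofReal_comp
  refine ((hs.mul_const (unitPhase q * p)).add (hc.mul_const r)).congr_deriv ?_
  simp only [id]
  push_cast
  ring

variable {p q}

lemma hasDerivAt_twistFst_field (h : 0 < gap p q) :
    HasDerivAt (fun s : ℝ => twistFst (s * l) (s * m) p q r)
      (-(m * Complex.I) * twistFst (t * l) (t * m) p q r - l *
        (conj (unitPhase (twistSnd (t * l) (t * m) p q r)) * twistThd (t * l) p q r)) t := by
  refine (hasDerivAt_twistFst l m p q r t).congr_deriv ?_
  rw [unitPhase_mul_conj (ne_zero_of_gap_pos h), unitPhase_twistSnd h, map_mul, conj_exp]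
  ring

lemma hasDerivAt_twistThd_field (h : 0 < gap p q) :
    HasDerivAt (fun s : ℝ => twistThd (s * l) p q r)
      (l * (unitPhase (twistSnd (t * l) (t * m) p q r) * twistFst (t * l) (t * m) p q r)) t := by
  rw [unitPhase_twistSnd_mul h]
  exact hasDerivAt_twistThd l p q r t

lemma hasDerivAt_twistSnd_field (h : 0 < gap p q) :
    HasDerivAt (fun s : ℝ => twistSnd (s * l) (s * m) p q r)
      (m * Complex.I * twistSnd (t * l) (t * m) p q r - l *
        (unitPhase (twistSnd (t * l) (t * m) p q r) *
          (((conj (unitPhase (twistSnd (t * l) (t * m) p q r) * twistFst (t * l) (t * m) p q r) *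
            twistThd (t * l) p q r).re / ‖twistSnd (t * l) (t * m) p q r‖ : ℝ) : ℂ))) t := by
  have h1 := ((hasDerivAt_normSq (hasDerivAt_twistFst_field l m r t h)).const_add
    (gap p q)).sqrt (gap_add_normSq_pos h _).ne'
  refine (((hasDerivAt_exp_mul_I m t).mul_const (unitPhase q)).mul h1.ofReal_comp).congr_deriv ?_
  rw [norm_twistSnd h]
  -- The rotational part of the velocity is tangent to the circle and does not change the modulus.
  have e : (conj (twistFst (t * l) (t * m) p q r) *
      (-(m * Complex.I) * twistFst (t * l) (t * m) p q r - l *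
        (conj (unitPhase (twistSnd (t * l) (t * m) p q r)) * twistThd (t * l) p q r))).re
      = - l * (conj (unitPhase (twistSnd (t * l) (t * m) p q r) *
        twistFst (t * l) (t * m) p q r) * twistThd (t * l) p q r).re := by
    generalize twistFst (t * l) (t * m) p q r = A
    generalize unitPhase (twistSnd (t * l) (t * m) p q r) = u
    simp
    ring
  rw [e, ← unitPhase_twistSnd h (t * l) (t * m) r]
  conv_rhs => rw [show m * Complex.I * twistSnd (t * l) (t * m) p q r = m * Complex.I *
    (unitPhase (twistSnd (t * l) (t * m) p q r) * (‖twistSnd (t * l) (t * m) p q r‖ : ℂ)) by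
      rw [unitPhase_mul_norm], norm_twistSnd h]
  rw [mul_assoc (m * Complex.I : ℂ), ← unitPhase_twistSnd h (t * l) (t * m) r]
  push_cast
  rw [mul_div_mul_left _ _ (two_ne_zero)]
  ring

end time

/-- Only the part of the velocity orthogonal to `Q` turns the phase; the radial part changes the
norm. -/
lemma hasDerivAt_unitPhase {Q : ℝ → ℂ} {Q' : ℂ} {t : ℝ} (h : HasDerivAt Q Q' t) (hq : Q t ≠ 0) :
    HasDerivAt (fun s => unitPhase (Q s))
      (unitPhase (Q t) * Complex.I * (((conj (unitPhase (Q t)) * Q').im / ‖Q t‖ : ℝ) : ℂ)) t := by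
  have hn : HasDerivAt (fun s => ‖Q s‖) ((conj (unitPhase (Q t)) * Q').re) t := by
    have h1 := (hasDerivAt_normSq h).sqrt (by simpa using hq)
    refine h1.congr_deriv ?_
    rw [← Complex.norm_def, unitPhase, map_div₀, Complex.conj_ofReal, div_mul_eq_mul_div,
      Complex.div_ofReal_re]
    rw [mul_div_mul_left _ _ two_ne_zero]
  have hN : (‖Q t‖ : ℂ) ≠ 0 := by simpa using hq
  refine (h.div hn.ofReal_comp hN).congr_deriv ?_
  have h2 := unitPhase_mul_norm (Q t)
  have h3 := unitPhase_mul_conj hq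
  have h4 := Complex.re_add_im (conj (unitPhase (Q t)) * Q')
  push_cast
  generalize unitPhase (Q t) = u at *
  generalize ((conj u * Q').re : ℂ) = a at *
  generalize ((conj u * Q').im : ℂ) = b at *
  generalize (‖Q t‖ : ℂ) = N at *
  field_simp
  linear_combination a * h2 - N * u * h4 - N * Q' * h3

lemma hasDerivAt_twistMoment {P Q R : ℝ → ℂ} {P' Q' R' : ℂ} {t : ℝ} (hP : HasDerivAt P P' t)
    (hQ : HasDerivAt Q Q' t) (hR : HasDerivAt R R' t) (hq : Q t ≠ 0) :
    HasDerivAt (fun s => twistMoment (P s) (Q s) (R s))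
      ((conj (unitPhase (Q t) * P') * R t).im + (conj (unitPhase (Q t) * P t) * R').im
        - (conj (unitPhase (Q t) * P t) * R t).re / ‖Q t‖ * (conj (unitPhase (Q t)) * Q').im) t := by
  have h := Complex.imCLM.hasFDerivAt.comp_hasDerivAt t
    (((hasDerivAt_unitPhase hQ hq).mul hP).star.mul hR)
  refine h.congr_deriv ?_
  simp
  ring

lemma hasDerivAt_gap {P Q : ℝ → ℂ} {P' Q' : ℂ} {t : ℝ} (hP : HasDerivAt P P' t)
    (hQ : HasDerivAt Q Q' t) :
    HasDerivAt (fun s => gap (P s) (Q s))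
      (2 * (conj (Q t) * Q').re - 2 * (conj (P t) * P').re) t :=
  (hasDerivAt_normSq hQ).sub (hasDerivAt_normSq hP)

/-! ### The twist as a Hamiltonian flow on the whole space. -/

section smooth

variable {n : ℕ}

lemma contDiff_coord (l : Fin n) : ContDiff ℝ ∞ fun z : Space n => z l := contDiff_piLp_apply 2

lemma contDiffAt_conj {f : Space n → ℂ} {z : Space n} (hf : ContDiffAt ℝ ∞ f z) :
    ContDiffAt ℝ ∞ (fun z => conj (f z)) z :=
  Complex.conjCLE.contDiff.contDiffAt.comp z hf

lemma contDiffAt_ofReal {f : Space n → ℝ} {z : Space n} (hf : ContDiffAt ℝ ∞ f z) :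
    ContDiffAt ℝ ∞ (fun z => (f z : ℂ)) z :=
  Complex.ofRealCLM.contDiff.contDiffAt.comp z hf

lemma contDiffAt_normSq {f : Space n → ℂ} {z : Space n} (hf : ContDiffAt ℝ ∞ f z) :
    ContDiffAt ℝ ∞ (fun z => Complex.normSq (f z)) z := by
  simp only [Complex.normSq_eq_norm_sq]
  exact (contDiff_norm_sq ℝ).contDiffAt.comp z hf

lemma contDiff_gap (i j : Fin n) : ContDiff ℝ ∞ fun z : Space n => gap (z i) (z j) :=
  contDiff_iff_contDiffAt.2 fun _ => (contDiffAt_normSq (contDiff_coord j).contDiffAt).sub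
    (contDiffAt_normSq (contDiff_coord i).contDiffAt)

lemma contDiffAt_unitPhase (j : Fin n) {z : Space n} (hz : z j ≠ 0) :
    ContDiffAt ℝ ∞ (fun z : Space n => unitPhase (z j)) z := by
  have h1 : ContDiffAt ℝ ∞ (fun z : Space n => z j) z := (contDiff_coord j).contDiffAt
  have h2 : ContDiffAt ℝ ∞ (fun z : Space n => (‖z j‖ : ℂ)) z := contDiffAt_ofReal (h1.norm ℝ hz)
  have h3 : (‖z j‖ : ℂ) ≠ 0 := by simpa using hz
  simp only [unitPhase, div_eq_mul_inv]
  exact h1.mul (h2.inv h3)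

lemma contDiffAt_twistMoment (i j k : Fin n) {z : Space n} (hz : z j ≠ 0) :
    ContDiffAt ℝ ∞ (fun z : Space n => twistMoment (z i) (z j) (z k)) z :=
  Complex.imCLM.contDiff.contDiffAt.comp z ((contDiffAt_conj ((contDiffAt_unitPhase j hz).mul
    (contDiff_coord i).contDiffAt)).mul (contDiff_coord k).contDiffAt)

end smooth

section flow

variable {n : ℕ} (lam : ℝ → ℝ) (i j k : Fin n)

/-- Differentiating the factor `lam (gap ..)` of the Hamiltonian contributes the rotation generated
by `gap`, at this speed. Since `gap` and `twistMoment` are conserved, so is the speed, and the flow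
has a closed form. -/
def twistSpeed (z : Space n) : ℝ :=
  -2 * deriv lam (gap (z i) (z j)) * twistMoment (z i) (z j) (z k)

def twistHamiltonian (z : Space n) : ℝ := lam (gap (z i) (z j)) * twistMoment (z i) (z j) (z k)

/-- The Hamiltonian vector field of `twistHamiltonian`. -/
def twistField (z : Space n) : Space n :=
  WithLp.toLp 2 fun l =>
    if l = i then -(twistSpeed lam i j k z * Complex.I) * z i -
      lam (gap (z i) (z j)) * (conj (unitPhase (z j)) * z k)
    else if l = j then twistSpeed lam i j k z * Complex.I * z j -
      lam (gap (z i) (z j)) * (unitPhase (z j) *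
        (((conj (unitPhase (z j) * z i) * z k).re / ‖z j‖ : ℝ) : ℂ))
    else if l = k then lam (gap (z i) (z j)) * (unitPhase (z j) * z i)
    else 0

/-- The flow of `twistField`. -/
def twistFlow (t : ℝ) (z : Space n) : Space n :=
  WithLp.toLp 2 fun l =>
    if l = i then twistFst (t * lam (gap (z i) (z j))) (t * twistSpeed lam i j k z)
      (z i) (z j) (z k)
    else if l = j then twistSnd (t * lam (gap (z i) (z j))) (t * twistSpeed lam i j k z)
      (z i) (z j) (z k)
    else if l = k then twistThd (t * lam (gap (z i) (z j))) (z i) (z j) (z k)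
    else z l

variable {lam i j k} {δ : ℝ}

lemma twistFlow_fst (t : ℝ) (z : Space n) : twistFlow lam i j k t z i =
    twistFst (t * lam (gap (z i) (z j))) (t * twistSpeed lam i j k z) (z i) (z j) (z k) := by
  simp [twistFlow]

lemma twistFlow_snd (hij : i ≠ j) (t : ℝ) (z : Space n) : twistFlow lam i j k t z j =
    twistSnd (t * lam (gap (z i) (z j))) (t * twistSpeed lam i j k z) (z i) (z j) (z k) := by
  simp [twistFlow, hij.symm]

lemma twistFlow_thd (hik : i ≠ k) (hjk : j ≠ k) (t : ℝ) (z : Space n) :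
    twistFlow lam i j k t z k = twistThd (t * lam (gap (z i) (z j))) (z i) (z j) (z k) := by
  simp [twistFlow, hik.symm, hjk.symm]

lemma twistFlow_of_ne (t : ℝ) (z : Space n) {l : Fin n} (h1 : l ≠ i) (h2 : l ≠ j) (h3 : l ≠ k) :
    twistFlow lam i j k t z l = z l := by
  simp [twistFlow, h1, h2, h3]

lemma sum_eq_add_three_of_off (hij : i ≠ j) (hik : i ≠ k) (hjk : j ≠ k) (f : Fin n → ℝ)
    (h : ∀ l, l ≠ i → l ≠ j → l ≠ k → f l = 0) : ∑ l, f l = f i + f j + f k := by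
  rw [← Finset.sum_subset (Finset.subset_univ {i, j, k}), Finset.sum_insert, Finset.sum_pair hjk]
  · ring
  · simp [hij, hik]
  · intro l _ hl
    simp only [Finset.mem_insert, Finset.mem_singleton, not_or] at hl
    exact h l hl.1 hl.2.1 hl.2.2

lemma twistSpeed_of_le (h' : ∀ s ≤ δ, deriv lam s = 0) {z : Space n} (hz : gap (z i) (z j) ≤ δ) :
    twistSpeed lam i j k z = 0 := by
  simp [twistSpeed, h' _ hz]

lemma twistFlow_of_le (h : ∀ s ≤ δ, lam s = 0) (h' : ∀ s ≤ δ, deriv lam s = 0) {z : Space n}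
    (hz : gap (z i) (z j) ≤ δ) (t : ℝ) : twistFlow lam i j k t z = z := by
  ext l
  simp only [twistFlow, h _ hz, twistSpeed_of_le h' hz, mul_zero, twistFst_zero, twistSnd_zero,
    twistThd_zero]
  split_ifs <;> simp_all

lemma twistField_of_le (h : ∀ s ≤ δ, lam s = 0) (h' : ∀ s ≤ δ, deriv lam s = 0) {z : Space n}
    (hz : gap (z i) (z j) ≤ δ) : twistField lam i j k z = 0 := by
  ext l
  simp [twistField, h _ hz, twistSpeed_of_le h' hz]

lemma gap_twistFlow (hij : i ≠ j) {z : Space n} (hz : 0 < gap (z i) (z j)) (t : ℝ) :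
    gap (twistFlow lam i j k t z i) (twistFlow lam i j k t z j) = gap (z i) (z j) := by
  rw [twistFlow_fst, twistFlow_snd hij, gap_twist hz]

lemma twistSpeed_twistFlow (hij : i ≠ j) (hik : i ≠ k) (hjk : j ≠ k) {z : Space n}
    (hz : 0 < gap (z i) (z j)) (t : ℝ) :
    twistSpeed lam i j k (twistFlow lam i j k t z) = twistSpeed lam i j k z := by
  rw [twistSpeed, gap_twistFlow hij hz, twistFlow_fst, twistFlow_snd hij, twistFlow_thd hik hjk,
    twistMoment_twist hz, twistSpeed]

lemma twistFlow_neg_twistFlow (hij : i ≠ j) (hik : i ≠ k) (hjk : j ≠ k) {z : Space n}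
    (hz : 0 < gap (z i) (z j)) (t : ℝ) :
    twistFlow lam i j k (-t) (twistFlow lam i j k t z) = z := by
  ext l
  by_cases h1 : l = i
  · subst h1
    rw [twistFlow_fst, gap_twistFlow hij hz, twistSpeed_twistFlow hij hik hjk hz, twistFlow_fst,
      twistFlow_snd hij, twistFlow_thd hik hjk, neg_mul, neg_mul, twistFst_neg_twist hz]
  by_cases h2 : l = j
  · subst h2
    rw [twistFlow_snd hij, gap_twistFlow hij hz, twistSpeed_twistFlow hij hik hjk hz,
      twistFlow_fst, twistFlow_snd hij, twistFlow_thd hik hjk, neg_mul, neg_mul,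
      twistSnd_neg_twist hz]
  by_cases h3 : l = k
  · subst h3
    rw [twistFlow_thd hik hjk, gap_twistFlow hij hz, twistFlow_fst, twistFlow_snd hij,
      twistFlow_thd hik hjk, neg_mul, twistThd_neg_twist hz]
  · rw [twistFlow_of_ne _ _ h1 h2 h3, twistFlow_of_ne _ _ h1 h2 h3]

lemma hasDerivAt_twistFlow (hij : i ≠ j) (hik : i ≠ k) (hjk : j ≠ k) {z : Space n}
    (hz : 0 < gap (z i) (z j)) (t : ℝ) :
    HasDerivAt (fun s => twistFlow lam i j k s z) (twistField lam i j k (twistFlow lam i j k t z))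
      t := by
  refine hasDerivAt_space fun l => ?_
  have e1 := twistFlow_fst (lam := lam) (i := i) (j := j) (k := k) t z
  have e2 := twistFlow_snd (lam := lam) (k := k) hij t z
  have e3 := twistFlow_thd (lam := lam) hik hjk t z
  simp only [twistField, gap_twistFlow hij hz, twistSpeed_twistFlow hij hik hjk hz]
  rw [e1, e2, e3]
  split_ifs with h1 h2 h3
  · subst h1
    simp only [twistFlow_fst]
    exact hasDerivAt_twistFst_field _ _ _ t hz
  · subst h2
    simp only [twistFlow_snd hij]
    exact hasDerivAt_twistSnd_field _ _ _ t hz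
  · subst h3
    simp only [twistFlow_thd hik hjk]
    exact hasDerivAt_twistThd_field _ _ _ t hz
  · simp only [twistFlow_of_ne _ _ h1 h2 h3]
    exact hasDerivAt_const _ _

lemma stdForm_twistField (hij : i ≠ j) (hik : i ≠ k) (hjk : j ≠ k) (hlam : Differentiable ℝ lam)
    {z : Space n} (hz : z j ≠ 0) (hH : DifferentiableAt ℝ (twistHamiltonian lam i j k) z)
    (v : Space n) :
    stdForm (twistField lam i j k z) v = fderiv ℝ (twistHamiltonian lam i j k) z v := by
  symm
  refine fderiv_eq_of_hasDerivAt_line hH ?_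
  have hl : ∀ l, HasDerivAt (fun s : ℝ => (z + s • v) l) (v l) 0 := fun l => by
    simpa using ((hasDerivAt_id (0 : ℝ)).ofReal_comp.mul_const (v l)).const_add (z l)
  have hz' : (z + (0 : ℝ) • v) j ≠ 0 := by simpa using hz
  have h := (((hlam _).hasDerivAt.comp (0 : ℝ) (hasDerivAt_gap (hl i) (hl j)))).mul
    (hasDerivAt_twistMoment (hl i) (hl j) (hl k) hz')
  refine h.congr_deriv ?_
  rw [stdForm, sum_eq_add_three_of_off hij hik hjk]
  · simp only [twistField, if_true, if_neg hij.symm, if_neg hik.symm, if_neg hjk.symm, zero_smul,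
      add_zero, Function.comp_apply, twistSpeed]
    generalize twistMoment (z i) (z j) (z k) = F
    generalize (conj (unitPhase (z j) * z i) * z k).re / ‖z j‖ = R
    generalize lam (gap (z i) (z j)) = g
    generalize deriv lam (gap (z i) (z j)) = g'
    generalize unitPhase (z j) = u
    simp
    ring
  · intro l h1 h2 h3
    simp [twistField, h1, h2, h3]

lemma eventually_gap_lt {z : Space n} (hz : gap (z i) (z j) < δ) :
    ∀ᶠ w in nhds z, gap (w i) (w j) < δ :=
  (contDiff_gap i j).continuous.continuousAt.eventually_lt_const hz

/-- The phase of `z j` is singular only at `z j = 0`, where `gap` is at most 0; the cutoff `lam`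
vanishes on a neighbourhood of such points. -/
lemma contDiff_twistHamiltonian (hδ : 0 < δ) (hlam : ContDiff ℝ ∞ lam) (h : ∀ s ≤ δ, lam s = 0) :
    ContDiff ℝ ∞ (twistHamiltonian lam i j k : Space n → ℝ) := by
  refine contDiff_iff_contDiffAt.2 fun z => ?_
  rcases lt_or_ge (gap (z i) (z j)) δ with hz | hz
  · refine (contDiffAt_const (c := (0 : ℝ))).congr_of_eventuallyEq ?_
    filter_upwards [eventually_gap_lt hz] with w hw
    simp [twistHamiltonian, h _ hw.le]
  · exact (hlam.contDiffAt.comp z (contDiff_gap i j).contDiffAt).mul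
      (contDiffAt_twistMoment i j k (ne_zero_of_gap_pos (hδ.trans_le hz)))

lemma contDiff_twistFlow (hδ : 0 < δ) (hlam : ContDiff ℝ ∞ lam) (h : ∀ s ≤ δ, lam s = 0)
    (h' : ∀ s ≤ δ, deriv lam s = 0) (t : ℝ) :
    ContDiff ℝ ∞ (twistFlow lam i j k t : Space n → Space n) := by
  refine contDiff_iff_contDiffAt.2 fun z => ?_
  rcases lt_or_ge (gap (z i) (z j)) δ with hz | hz
  · refine contDiffAt_id.congr_of_eventuallyEq ?_
    filter_upwards [eventually_gap_lt hz] with w hw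
    exact twistFlow_of_le h h' hw.le t
  have hpos := hδ.trans_le hz
  have hq := ne_zero_of_gap_pos hpos
  have hu := contDiffAt_unitPhase j hq
  have hc : ∀ l : Fin n, ContDiffAt ℝ ∞ (fun z : Space n => z l) z :=
    fun l => (contDiff_coord l).contDiffAt
  have hg := (contDiff_gap i j).contDiffAt (x := z)
  have hτ : ContDiffAt ℝ ∞ (fun z : Space n => t * lam (gap (z i) (z j))) z :=
    contDiffAt_const.mul (hlam.contDiffAt.comp z hg)
  have hθ : ContDiffAt ℝ ∞ (fun z : Space n => t * twistSpeed lam i j k z) z :=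
    contDiffAt_const.mul ((contDiffAt_const.mul
      (((contDiff_infty_iff_deriv).1 hlam).2.contDiffAt.comp z hg)).mul
      (contDiffAt_twistMoment i j k hq))
  have hcos := contDiffAt_ofReal hτ.cos
  have hsin := contDiffAt_ofReal hτ.sin
  have hθI := (contDiffAt_ofReal hθ).mul (contDiffAt_const (c := Complex.I))
  have h1 : ContDiffAt ℝ ∞ (fun z : Space n => twistFst (t * lam (gap (z i) (z j)))
      (t * twistSpeed lam i j k z) (z i) (z j) (z k)) z :=
    hθI.neg.cexp.mul ((hcos.mul (hc i)).sub (hsin.mul ((contDiffAt_conj hu).mul (hc k))))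
  refine (contDiffAt_piLp 2).2 fun l => ?_
  simp only [twistFlow]
  split_ifs
  · exact h1
  · exact (hθI.cexp.mul hu).mul (contDiffAt_ofReal
      ((hg.add (contDiffAt_normSq h1)).sqrt (gap_add_normSq_pos hpos _).ne'))
  · exact (hsin.mul (hu.mul (hc i))).add (hcos.mul (hc k))
  · exact hc l

lemma isHamiltonianIsotopy_twistFlow (hij : i ≠ j) (hik : i ≠ k) (hjk : j ≠ k) (hδ : 0 < δ)
    (hlam : ContDiff ℝ ∞ lam) (h : ∀ s ≤ δ, lam s = 0) (h' : ∀ s ≤ δ, deriv lam s = 0) :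
    IsHamiltonianIsotopy (twistFlow lam i j k) := by
  have hH := contDiff_twistHamiltonian (i := i) (j := j) (k := k) hδ hlam h
  refine IsHamiltonianIsotopy.of_flow _ (twistField lam i j k) hH (fun z v => ?_) (fun z => ?_)
    (fun z t => ?_) (contDiff_twistFlow hδ hlam h h') (fun t z => ?_)
  · rcases lt_or_ge (gap (z i) (z j)) δ with hz | hz
    · have e : twistHamiltonian lam i j k =ᶠ[nhds z] fun _ => 0 := by
        filter_upwards [eventually_gap_lt hz] with w hw
        simp [twistHamiltonian, h _ hw.le]
      rw [twistField_of_le h h' hz.le, e.fderiv_eq]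
      simp [stdForm]
    · exact stdForm_twistField hij hik hjk (hlam.differentiable (by simp))
        (ne_zero_of_gap_pos (hδ.trans_le hz)) (hH.differentiable (by simp) z) v
  · ext l
    simp only [twistFlow, zero_mul, twistFst_zero, twistSnd_zero, twistThd_zero]
    split_ifs <;> simp_all
  · rcases le_or_gt (gap (z i) (z j)) δ with hz | hz
    · simp only [twistFlow_of_le h h' hz, twistField_of_le h h' hz]
      exact hasDerivAt_const _ _
    · exact hasDerivAt_twistFlow hij hik hjk (hδ.trans hz) t
  · rcases le_or_gt (gap (z i) (z j)) δ with hz | hz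
    · simp only [twistFlow_of_le h h' hz]
    · exact twistFlow_neg_twistFlow hij hik hjk (hδ.trans hz) t

/-- The sum |z_i|² + |z_k|² and the difference |z_j|² - |z_i|² are conserved. So the total grows by
the increase of |z_i|², which is at most the initial |z_k|². -/
lemma sum_norm_sq_twistFlow_le (hij : i ≠ j) (hik : i ≠ k) (hjk : j ≠ k) {z : Space n}
    (hz : 0 < gap (z i) (z j)) (t : ℝ) :
    ∑ l, ‖twistFlow lam i j k t z l‖ ^ 2 ≤ ∑ l, ‖z l‖ ^ 2 + ‖z k‖ ^ 2 := by
  rw [← sub_le_iff_le_add', ← Finset.sum_sub_distrib, sum_eq_add_three_of_off hij hik hjk]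
  · simp only [twistFlow_fst, twistFlow_snd hij, twistFlow_thd hik hjk,
      ← Complex.normSq_eq_norm_sq, normSq_twistSnd hz]
    have h1 := normSq_twistFst_add_twistThd (ne_zero_of_gap_pos hz)
      (t * lam (gap (z i) (z j))) (t * twistSpeed lam i j k z) (z i) (z k)
    have h2 := Complex.normSq_nonneg (twistThd (t * lam (gap (z i) (z j))) (z i) (z j) (z k))
    have h3 : gap (z i) (z j) = Complex.normSq (z j) - Complex.normSq (z i) := rfl
    linarith
  · intro l h1 h2 h3
    rw [twistFlow_of_ne _ _ h1 h2 h3, sub_self]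

end flow

/-! ### The effect of the twist on product tori. -/

lemma normSq_twistFst_of_cos_eq_zero {q : ℂ} (hq : q ≠ 0) {τ : ℝ} (hτ : Real.cos τ = 0) (θ : ℝ)
    (p r : ℂ) : Complex.normSq (twistFst τ θ p q r) = Complex.normSq r := by
  have h := Real.sin_sq_add_cos_sq τ
  rw [hτ] at h
  rw [normSq_twistFst hq, hτ]
  simp only [Complex.ofReal_zero, zero_mul, zero_sub, Complex.normSq_neg, Complex.normSq_mul,
    Complex.normSq_ofReal]
  linear_combination Complex.normSq r * h

/-- A quarter turn exchanges the moduli at `i` and `k`, and conservation of `gap` fixes the one at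
`j`. Asking only for a vanishing cosine covers both time 1 and time -1. -/
lemma twistFlow_mem_torus {n : ℕ} {lam : ℝ → ℝ} {i j k : Fin n} (hij : i ≠ j) (hik : i ≠ k)
    (hjk : j ≠ k) {a a' : Fin n → ℝ} (ha : ∀ l, 0 < a l) (hlt : a i < a j) (hi : a' i = a k)
    (hj : a' j = a j + a k - a i) (hk : a' k = a i)
    (ho : ∀ l, l ≠ i → l ≠ j → l ≠ k → a' l = a l) {t : ℝ}
    (ht : Real.cos (t * lam ((a j - a i) / Real.pi)) = 0) {z : Space n} (hz : z ∈ torus a) :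
    twistFlow lam i j k t z ∈ torus a' := by
  have hsq : ∀ l, Complex.normSq (z l) = a l / Real.pi := fun l => by
    rw [Complex.normSq_eq_norm_sq, mem_torus_iff.1 hz l,
      Real.sq_sqrt (div_nonneg (ha l).le Real.pi_pos.le)]
  have hgap : gap (z i) (z j) = (a j - a i) / Real.pi := by
    rw [gap, hsq, hsq, sub_div]
  have hpos : 0 < gap (z i) (z j) := by
    rw [hgap]
    exact div_pos (sub_pos.2 hlt) Real.pi_pos
  have hq := ne_zero_of_gap_pos hpos
  rw [← hgap] at ht
  have h1 := normSq_twistFst_of_cos_eq_zero hq ht (t * twistSpeed lam i j k z) (z i) (z k)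
  have h2 := normSq_twistFst_add_twistThd hq (t * lam (gap (z i) (z j)))
    (t * twistSpeed lam i j k z) (z i) (z k)
  have h3 := normSq_twistSnd hpos (t * lam (gap (z i) (z j))) (t * twistSpeed lam i j k z) (z k)
  rw [h1] at h3 h2
  rw [mem_torus_iff]
  intro l
  rw [Complex.norm_def]
  congr 1
  by_cases e1 : l = i
  · subst e1
    rw [twistFlow_fst, h1, hi, hsq]
  by_cases e2 : l = j
  · subst e2
    rw [twistFlow_snd hij, h3, hgap, hj, hsq]
    ring
  by_cases e3 : l = k
  · subst e3
    rw [twistFlow_thd hik hjk, hk]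
    linarith [hsq i]
  · rw [twistFlow_of_ne _ _ e1 e2 e3, ho l e1 e2 e3, hsq]

lemma hamIsotopic_twist {n : ℕ} {i j k : Fin n} (hij : i ≠ j) (hik : i ≠ k)
    (hjk : j ≠ k) {a a' : Fin n → ℝ} (ha : ∀ l, 0 < a l) (hlt : a i < a j) (hi : a' i = a k)
    (hj : a' j = a j + a k - a i) (hk : a' k = a i)
    (ho : ∀ l, l ≠ i → l ≠ j → l ≠ k → a' l = a l) {b : ℝ} (hb : total a + a k ≤ b) :
    HamIsotopicInBall b (torus a) (torus a') := by
  set c := (a j - a i) / Real.pi with hc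
  have hcpos : 0 < c := div_pos (sub_pos.2 hlt) Real.pi_pos
  -- The constant `c` is the value of `gap` on both tori. The cutoff is 0 up to `c / 2` and reaches
  -- a quarter turn at `c`; the threshold `c / 3` used below leaves room for the derivative to
  -- vanish as well.
  set lam : ℝ → ℝ := fun s => Real.pi / 2 * Real.smoothTransition (2 * s / c - 1) with hlam
  have hlams : ContDiff ℝ ∞ lam :=
    contDiff_const.mul (Real.smoothTransition.contDiff.comp (by fun_prop))
  have hle : ∀ s ≤ c / 2, lam s = 0 := fun s hs => by
    have : 2 * s / c - 1 ≤ 0 := by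
      rw [sub_nonpos, div_le_one hcpos]
      linarith
    simp only [hlam, Real.smoothTransition.zero_of_nonpos this, mul_zero]
  have hle' : ∀ s ≤ c / 3, deriv lam s = 0 := fun s hs => by
    have : lam =ᶠ[nhds s] fun _ => 0 := by
      filter_upwards [gt_mem_nhds (show s < c / 2 by linarith)] with r hr using hle r hr.le
    simpa using this.deriv_eq
  have hlamc : lam c = Real.pi / 2 := by
    have : (1 : ℝ) ≤ 2 * c / c - 1 := by
      rw [mul_div_assoc, div_self hcpos.ne']
      norm_num
    simp only [hlam, Real.smoothTransition.one_of_one_le this, mul_one]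
  have ha' : ∀ l, 0 < a' l := fun l => by
    by_cases e1 : l = i
    · rw [e1, hi]; exact ha k
    by_cases e2 : l = j
    · rw [e2, hj]; linarith [ha k]
    by_cases e3 : l = k
    · rw [e3, hk]; exact ha i
    · rw [ho l e1 e2 e3]; exact ha l
  have hgap : ∀ (x : Fin n → ℝ), (∀ l, 0 < x l) → ∀ z ∈ torus x,
      gap (z i) (z j) = (x j - x i) / Real.pi := fun x hx z hz => by
    rw [gap, Complex.normSq_eq_norm_sq, Complex.normSq_eq_norm_sq, mem_torus_iff.1 hz,
      mem_torus_iff.1 hz, Real.sq_sqrt (div_nonneg (hx _).le Real.pi_pos.le),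
      Real.sq_sqrt (div_nonneg (hx _).le Real.pi_pos.le), sub_div]
  refine ⟨twistFlow lam i j k, isHamiltonianIsotopy_twistFlow hij hik hjk
    (show 0 < c / 3 by linarith) hlams (fun s hs => hle s (by linarith)) hle', ?_, ?_⟩
  · refine Subset.antisymm ?_ fun w hw => ?_
    · rintro _ ⟨z, hz, rfl⟩
      refine twistFlow_mem_torus hij hik hjk ha hlt hi hj hk ho ?_ hz
      rw [← hc, hlamc, one_mul, Real.cos_pi_div_two]
    · have hc' : (a' j - a' i) / Real.pi = c := by
        rw [hi, hj, hc]
        ring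
      refine ⟨twistFlow lam i j k (-1) w, ?_, ?_⟩
      · refine twistFlow_mem_torus hij hik hjk ha' ?_ hk.symm ?_ hi.symm
          (fun l h1 h2 h3 => (ho l h1 h2 h3).symm) ?_ hw
        · rw [hi, hj]; linarith
        · rw [hi, hj, hk]; ring
        · rw [hc', hlamc, neg_one_mul, Real.cos_neg, Real.cos_pi_div_two]
      · have h := twistFlow_neg_twistFlow (lam := lam) hij hik hjk (z := w)
          (by rw [hgap a' ha' w hw, hc']; exact hcpos) (-1)
        rwa [neg_neg] at h
  · rintro s - _ ⟨z, hz, rfl⟩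
    refine mem_ball_of_sum_le ((sum_norm_sq_twistFlow_le hij hik hjk
      (by rw [hgap a ha z hz]; exact hcpos) s).trans ?_)
    rw [sum_norm_sq_of_mem_torus ha hz, mem_torus_iff.1 hz,
      Real.sq_sqrt (div_nonneg (ha _).le Real.pi_pos.le), ← add_div]
    gcongr

/-- The twist followed by a swap of `i` and `k`, so that only the component at `j` has changed. -/
lemma hamIsotopic_update {n : ℕ} {i j k : Fin n} (hij : i ≠ j) (hik : i ≠ k)
    (hjk : j ≠ k) {a : Fin n → ℝ} (ha : ∀ l, 0 < a l) (hlt : a i < a j) {b : ℝ}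
    (hb : total a + a k ≤ b) :
    HamIsotopicInBall b (torus a) (torus (Function.update a j (a j + a k - a i))) := by
  set a' := Function.update a j (a j + a k - a i) with ha'
  have hpos : ∀ l, 0 < a' l := fun l => by
    rcases eq_or_ne l j with rfl | hl
    · simp only [ha', Function.update_self]
      linarith [ha k]
    · simpa [ha', hl] using ha l
  have htot : total a' ≤ b := by
    rw [total, Finset.sum_update_of_mem (Finset.mem_univ _)]
    have : total a = a j + ∑ l ∈ Finset.univ \ {j}, a l := by
      rw [total, ← Finset.sum_update_of_mem (Finset.mem_univ _), Function.update_eq_self]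
    linarith [ha i]
  have hpos' : ∀ l, 0 < a' (Equiv.swap i k l) := fun l => hpos _
  have h1 : HamIsotopicInBall b (torus a) (torus fun l => a' (Equiv.swap i k l)) := by
    refine hamIsotopic_twist hij hik hjk ha hlt ?_ ?_ ?_ ?_ hb
    · simp [ha', hjk.symm]
    · simp [ha', Equiv.swap_apply_of_ne_of_ne hij.symm hjk]
    · simp [ha', hij]
    · intro l h1 h2 h3
      simp [ha', Equiv.swap_apply_of_ne_of_ne h1 h3, h2]
  exact h1.trans (hamIsotopic_swap hpos i k htot).symm

/-! ### Nielsen equivalence of generating tuples. -/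

/-- The additive map `v ↦ v - f v • t i` kills `t i`, fixes the other generators, and is the
identity on the kernel of `f`. -/
lemma mem_closure_diff_of_map_eq_zero {ι V : Type*} [AddCommGroup V] {S : Set ι} {t : ι → V} (f : V →+ ℤ) {i : ι}
    (h1 : f (t i) = 1) (h0 : ∀ l ∈ S, l ≠ i → f (t l) = 0) {v : V}
    (hv : v ∈ AddSubgroup.closure (t '' S)) (hfv : f v = 0) :
    v ∈ AddSubgroup.closure (t '' (S \ {i})) := by
  suffices H : v - f v • t i ∈ AddSubgroup.closure (t '' (S \ {i})) by simpa [hfv] using H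
  clear hfv
  induction hv using AddSubgroup.closure_induction with
  | mem v hv =>
    obtain ⟨l, hl, rfl⟩ := hv
    rcases eq_or_ne l i with rfl | hli
    · simp [h1]
    · rw [h0 l hl hli, zero_smul, sub_zero]
      exact AddSubgroup.subset_closure ⟨l, ⟨hl, hli⟩, rfl⟩
  | zero => simp
  | add v w _ _ ihv ihw =>
    rw [map_add, add_smul, add_sub_add_comm]
    exact add_mem ihv ihw
  | neg v _ ih =>
    rw [map_neg, neg_smul, ← neg_sub']
    exact neg_mem ih

lemma isUnit_of_dvd_of_closure_eq_top {ι V : Type*} [AddCommGroup V] {S : Set ι} {t : ι → V}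
    (ht : AddSubgroup.closure (t '' S) = ⊤) (f : V →+ ℤ) {v : V} (hv : f v = 1) {c : ℤ}
    (hc : ∀ l ∈ S, c ∣ f (t l)) : IsUnit c := by
  have : ∀ w : V, c ∣ f w := fun w => by
    have hw : w ∈ AddSubgroup.closure (t '' S) := by simp [ht]
    induction hw using AddSubgroup.closure_induction with
    | mem w hw => obtain ⟨l, hl, rfl⟩ := hw; exact hc l hl
    | zero => simp
    | add v w _ _ ihv ihw => rw [map_add]; exact dvd_add ihv ihw
    | neg v _ ih => rw [map_neg]; exact (dvd_neg).2 ih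
  exact isUnit_of_dvd_one (hv ▸ this v)

section nielsen

variable {ι V W : Type*} [DecidableEq ι] [AddCommGroup V] [AddCommGroup W]

/-- The elementary Nielsen moves between tuples that involve only the indices in `S`. -/
inductive NielsenMove (S : Set ι) : (ι → V) → (ι → V) → Prop
  | add (t : ι → V) (i j : ι) (hi : i ∈ S) (hj : j ∈ S) (hij : i ≠ j) :
      NielsenMove S t (Function.update t i (t i + t j))
  | neg (t : ι → V) (i : ι) (hi : i ∈ S) : NielsenMove S t (Function.update t i (-t i))

/-- Nielsen equivalence of tuples through moves that involve only the indices in `S`. -/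
def NielsenEquiv (S : Set ι) : (ι → V) → (ι → V) → Prop := Relation.EqvGen (NielsenMove S)

namespace NielsenEquiv

variable {S T : Set ι} {t t' t'' : ι → V}

lemma refl (t : ι → V) : NielsenEquiv S t t := Relation.EqvGen.refl t

lemma symm (h : NielsenEquiv S t t') : NielsenEquiv S t' t := Relation.EqvGen.symm _ _ h

lemma trans (h : NielsenEquiv S t t') (h' : NielsenEquiv S t' t'') : NielsenEquiv S t t'' :=
  Relation.EqvGen.trans _ _ _ h h'

lemma add (t : ι → V) {i j : ι} (hi : i ∈ S) (hj : j ∈ S) (hij : i ≠ j) :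
    NielsenEquiv S t (Function.update t i (t i + t j)) :=
  Relation.EqvGen.rel _ _ (.add t i j hi hj hij)

lemma neg (t : ι → V) {i : ι} (hi : i ∈ S) : NielsenEquiv S t (Function.update t i (-t i)) :=
  Relation.EqvGen.rel _ _ (.neg t i hi)

lemma sub (t : ι → V) {i j : ι} (hi : i ∈ S) (hj : j ∈ S) (hij : i ≠ j) :
    NielsenEquiv S t (Function.update t i (t i - t j)) := by
  have h := add (Function.update t i (t i - t j)) hi hj hij
  simp only [Function.update_self, Function.update_of_ne hij.symm, sub_add_cancel,
    Function.update_idem, Function.update_eq_self] at h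
  exact h.symm

lemma mono (hST : S ⊆ T) (h : NielsenEquiv S t t') : NielsenEquiv T t t' := by
  induction h with
  | rel t t' h =>
    cases h with
    | add i j hi hj hij => exact add _ (hST hi) (hST hj) hij
    | neg i hi => exact neg _ (hST hi)
  | refl t => exact refl t
  | symm _ _ _ ih => exact ih.symm
  | trans _ _ _ _ _ ih ih' => exact ih.trans ih'

lemma eq_of_notMem (h : NielsenEquiv S t t') {l : ι} (hl : l ∉ S) : t l = t' l := by
  induction h with
  | rel t t' h =>
    cases h with
    | add i j hi hj hij => rw [Function.update_of_ne (ne_of_mem_of_not_mem hi hl).symm]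
    | neg i hi => rw [Function.update_of_ne (ne_of_mem_of_not_mem hi hl).symm]
  | refl t => rfl
  | symm _ _ _ ih => exact ih.symm
  | trans _ _ _ _ _ ih ih' => exact ih.trans ih'

lemma map (φ : V →+ W) (h : NielsenEquiv S t t') :
    NielsenEquiv S (fun l => φ (t l)) (fun l => φ (t' l)) := by
  induction h with
  | rel t t' h =>
    cases h with
    | add i j hi hj hij =>
      have := add (fun l => φ (t l)) hi hj hij
      convert this using 1
      ext l
      rcases eq_or_ne l i with rfl | hl <;> simp [*]
    | neg i hi =>
      have := neg (fun l => φ (t l)) hi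
      convert this using 1
      ext l
      rcases eq_or_ne l i with rfl | hl <;> simp [*]
  | refl t => exact refl _
  | symm _ _ _ ih => exact ih.symm
  | trans _ _ _ _ _ ih ih' => exact ih.trans ih'

open Classical in
lemma congr (h : NielsenEquiv S t t') (v : ι → V) :
    NielsenEquiv S (fun l => if l ∈ S then t l else v l) (fun l => if l ∈ S then t' l else v l) := by
  induction h with
  | rel t t' h =>
    cases h with
    | add i j hi hj hij =>
      have := add (fun l => if l ∈ S then t l else v l) hi hj hij
      convert this using 1
      ext l
      rcases eq_or_ne l i with rfl | hl <;> simp [*]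
    | neg i hi =>
      have := neg (fun l => if l ∈ S then t l else v l) hi
      convert this using 1
      ext l
      rcases eq_or_ne l i with rfl | hl <;> simp [*]
  | refl t => exact refl _
  | symm _ _ _ ih => exact ih.symm
  | trans _ _ _ _ _ ih ih' => exact ih.trans ih'

/-- Both directions are proved at once so that the induction passes through the symmetric case. -/
lemma exists_lift_aux (π : V →+ W) {s s' : ι → W} (h : NielsenEquiv S s s') :
    (∀ t : ι → V, (∀ l, π (t l) = s l) → ∃ t', NielsenEquiv S t t' ∧ ∀ l, π (t' l) = s' l) ∧
    (∀ t : ι → V, (∀ l, π (t l) = s' l) → ∃ t', NielsenEquiv S t t' ∧ ∀ l, π (t' l) = s l) := by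
  induction h with
  | rel s s' h =>
    cases h with
    | add i j hi hj hij =>
      refine ⟨fun t ht => ⟨_, add t hi hj hij, fun l => ?_⟩,
        fun t ht => ⟨_, sub t hi hj hij, fun l => ?_⟩⟩
      · rcases eq_or_ne l i with rfl | hl <;> simp [*]
      · rcases eq_or_ne l i with rfl | hl
        · simp [ht, hij.symm]
        · simp [ht, hl]
    | neg i hi =>
      refine ⟨fun t ht => ⟨_, neg t hi, fun l => ?_⟩, fun t ht => ⟨_, neg t hi, fun l => ?_⟩⟩
      · rcases eq_or_ne l i with rfl | hl <;> simp [*]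
      · rcases eq_or_ne l i with rfl | hl <;> simp [*]
  | refl s => exact ⟨fun t ht => ⟨t, refl t, ht⟩, fun t ht => ⟨t, refl t, ht⟩⟩
  | symm _ _ _ ih => exact ih.symm
  | trans _ _ _ _ _ ih ih' =>
    refine ⟨fun t ht => ?_, fun t ht => ?_⟩
    · obtain ⟨t1, h1, h1'⟩ := ih.1 t ht
      obtain ⟨t2, h2, h2'⟩ := ih'.1 t1 h1'
      exact ⟨t2, h1.trans h2, h2'⟩
    · obtain ⟨t1, h1, h1'⟩ := ih'.2 t ht
      obtain ⟨t2, h2, h2'⟩ := ih.2 t1 h1'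
      exact ⟨t2, h1.trans h2, h2'⟩

lemma exists_lift (π : V →+ W) {s s' : ι → W} (h : NielsenEquiv S s s') (t : ι → V)
    (ht : ∀ l, π (t l) = s l) : ∃ t', NielsenEquiv S t t' ∧ ∀ l, π (t' l) = s' l :=
  (exists_lift_aux π h).1 t ht

lemma closure_eq (h : NielsenEquiv S t t') :
    AddSubgroup.closure (t '' S) = AddSubgroup.closure (t' '' S) := by
  induction h with
  | rel t t' h =>
    have hm : ∀ (t : ι → V) {l : ι}, l ∈ S → t l ∈ AddSubgroup.closure (t '' S) :=
      fun t l hl => AddSubgroup.subset_closure (mem_image_of_mem t hl)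
    cases h with
    | add i j hi hj hij =>
      have e : t i + t j ∈ AddSubgroup.closure (Function.update t i (t i + t j) '' S) := by
        simpa using hm (Function.update t i (t i + t j)) hi
      have e' : t j ∈ AddSubgroup.closure (Function.update t i (t i + t j) '' S) := by
        simpa [hij.symm] using hm (Function.update t i (t i + t j)) hj
      apply le_antisymm <;> rw [AddSubgroup.closure_le] <;> rintro _ ⟨l, hl, rfl⟩
      · rcases eq_or_ne l i with rfl | hne
        · simpa using sub_mem e e'
        · simpa [hne] using hm (Function.update t i (t i + t j)) hl
      · rcases eq_or_ne l i with rfl | hne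
        · simpa using add_mem (hm t hl) (hm t hj)
        · simpa [hne] using hm t hl
    | neg i hi =>
      apply le_antisymm <;> rw [AddSubgroup.closure_le] <;> rintro _ ⟨l, hl, rfl⟩
      · rcases eq_or_ne l i with rfl | hne
        · simpa using hm (Function.update t l (-t l)) hl
        · simpa [hne] using hm (Function.update t i (-t i)) hl
      · rcases eq_or_ne l i with rfl | hne
        · simpa using hm t hl
        · simpa [hne] using hm t hl
  | refl t => rfl
  | symm _ _ _ ih => exact ih.symm
  | trans _ _ _ _ _ ih ih' => exact ih.trans ih'

lemma add_mem_closure {i : ι} (hi : i ∈ S) {v : V}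
    (hv : v ∈ AddSubgroup.closure (t '' (S \ {i}))) :
    NielsenEquiv S t (Function.update t i (t i + v)) := by
  -- The entry at `i` is left free, so that successive additions to it can be composed.
  suffices H : ∀ t' : ι → V, (∀ l ∈ S \ {i}, t' l = t l) →
      NielsenEquiv S t' (Function.update t' i (t' i + v)) from H t fun _ _ => rfl
  induction hv using AddSubgroup.closure_induction with
  | mem v hv =>
    obtain ⟨j, hj, rfl⟩ := hv
    intro t' ht'
    rw [← ht' j hj]
    exact add t' hi hj.1 (Ne.symm hj.2)
  | zero => intro t' _; simpa using refl t'
  | add v w _ _ ihv ihw =>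
    intro t' ht'
    have h := ihw (Function.update t' i (t' i + v)) fun l hl => by
      rw [Function.update_of_ne hl.2, ht' l hl]
    rw [Function.update_self, Function.update_idem, add_assoc] at h
    exact (ihv t' ht').trans h
  | neg v _ ih =>
    intro t' ht'
    have h := ih (Function.update t' i (t' i + -v)) fun l hl => by
      rw [Function.update_of_ne hl.2, ht' l hl]
    rw [Function.update_self, Function.update_idem, neg_add_cancel_right,
      Function.update_eq_self] at h
    exact h.symm

/-- The Euclidean algorithm on the values of a homomorphism. -/
lemma exists_eq_one [Fintype ι] (f : V →+ ℤ) {i : ι} (hi : i ∈ S) (t : ι → V)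
    (ht : ∀ c : ℤ, (∀ l ∈ S, c ∣ f (t l)) → IsUnit c) :
    ∃ t', NielsenEquiv S t t' ∧ f (t' i) = 1 ∧ ∀ l ∈ S, l ≠ i → f (t' l) = 0 := by
  induction hN : ∑ l, (f (t l)).natAbs using Nat.strong_induction_on generalizing t with
  | _ N ih =>
  -- While two values are nonzero, the larger in absolute value is decreased by adding or
  -- subtracting the other, according to the signs.
  by_cases h : ∃ j ∈ S, ∃ l ∈ S, j ≠ l ∧ f (t j) ≠ 0 ∧ f (t l) ≠ 0 ∧
      (f (t l)).natAbs ≤ (f (t j)).natAbs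
  · obtain ⟨j, hj, l, hl, hjl, hj0, hl0, hle⟩ := h
    have key : ∀ v : V, (f v).natAbs < (f (t j)).natAbs →
        NielsenEquiv S t (Function.update t j v) →
        (∀ c : ℤ, c ∣ f (t l) → c ∣ f v → c ∣ f (t j)) →
        ∃ t', NielsenEquiv S t t' ∧ f (t' i) = 1 ∧ ∀ l ∈ S, l ≠ i → f (t' l) = 0 := by
      intro v hv hE hd
      have hlt : ∑ m, (f (Function.update t j v m)).natAbs < N := by
        rw [← hN]
        refine Finset.sum_lt_sum (fun m _ => ?_) ⟨j, Finset.mem_univ _, by simpa using hv⟩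
        rcases eq_or_ne m j with rfl | hm
        · simpa using hv.le
        · simp [hm]
      obtain ⟨t', h1, h2⟩ := ih _ hlt (Function.update t j v) (fun c hc => ht c fun m hm => by
        rcases eq_or_ne m j with rfl | hmj
        · exact hd c (by simpa [hjl.symm] using hc l hl) (by simpa using hc m hm)
        · simpa [hmj] using hc m hm) rfl
      exact ⟨t', hE.trans h1, h2⟩
    by_cases hs : 0 < f (t j) ↔ 0 < f (t l)
    · refine key (t j - t l) ?_ (sub t hj hl hjl) fun c h1 h2 => ?_
      · rw [map_sub]; omega
      · simpa using dvd_add h2 h1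
    · refine key (t j + t l) ?_ (add t hj hl hjl) fun c h1 h2 => ?_
      · rw [map_add]; omega
      · simpa using dvd_sub h2 h1
  · have hz : ∃ j ∈ S, f (t j) ≠ 0 := by
      by_contra! hcon
      have := ht 0 fun l hl => by rw [hcon l hl]
      simp at this
    obtain ⟨j, hj, hj0⟩ := hz
    have hoth : ∀ l ∈ S, l ≠ j → f (t l) = 0 := by
      intro l hl hlj
      by_contra hl0
      rcases le_total (f (t l)).natAbs (f (t j)).natAbs with hle | hle
      · exact h ⟨j, hj, l, hl, hlj.symm, hj0, hl0, hle⟩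
      · exact h ⟨l, hl, j, hj, hlj, hl0, hj0, hle⟩
    have hu : IsUnit (f (t j)) := ht _ fun l hl => by
      rcases eq_or_ne l j with rfl | hlj
      · rfl
      · rw [hoth l hl hlj]; exact dvd_zero _
    obtain ⟨t1, h1, h1j, h1o⟩ : ∃ t1, NielsenEquiv S t t1 ∧ f (t1 j) = 1 ∧
        ∀ l ∈ S, l ≠ j → f (t1 l) = 0 := by
      rcases Int.isUnit_iff.1 hu with hu | hu
      · exact ⟨t, refl t, hu, hoth⟩
      · refine ⟨_, neg t hj, by simp [hu], fun l hl hlj => ?_⟩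
        simpa [hlj] using hoth l hl hlj
    rcases eq_or_ne j i with rfl | hji
    · exact ⟨t1, h1, h1j, h1o⟩
    -- The value 1 is moved from `j` to `i`: (0, 1) becomes (1, 1) and then (1, 0).
    have h2 := add t1 hi hj hji.symm
    have h3 := sub (Function.update t1 i (t1 i + t1 j)) hj hi hji
    refine ⟨_, h1.trans (h2.trans h3), ?_, fun l hl hli => ?_⟩
    · simp [hji.symm, h1j, h1o i hi hji.symm]
    · rcases eq_or_ne l j with rfl | hlj
      · simp [hji, h1o i hi hji.symm]
      · simp [hli, hlj, h1o l hl hlj]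

end NielsenEquiv

end nielsen

/-! ### Tuples generating the same group are Nielsen equivalent. -/

section generation

variable {ι : Type*} [DecidableEq ι] [Fintype ι]

/-- Induction on the rank. The Euclidean algorithm on the first coordinate leaves it nonzero, equal
to 1, only at `i`. The other entries then generate its kernel, so the entry at `i` can be corrected
to the first unit vector, and the tails of the others generate ℤ^r. -/
lemma nielsenEquiv_of_closure_eq_top_fin (r : ℕ) (S : Set ι) (t t' : ι → Fin r → ℤ)
    (ht : AddSubgroup.closure (t '' S) = ⊤) (ht' : AddSubgroup.closure (t' '' S) = ⊤)
    (heq : ∀ l, l ∉ S → t l = t' l) : NielsenEquiv S t t' := by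
  induction r generalizing S with
  | zero =>
    rw [show t = t' from funext fun l => Subsingleton.elim _ _]
    exact NielsenEquiv.refl _
  | succ r ih =>
    set f : (Fin (r + 1) → ℤ) →+ ℤ := Pi.evalAddMonoidHom (fun _ => ℤ) 0 with hf
    set e : Fin (r + 1) → ℤ := Pi.single 0 1 with he
    have hfe : f e = 1 := by simp [hf, he]
    obtain ⟨i, hi⟩ : S.Nonempty := by
      rw [nonempty_iff_ne_empty]
      rintro rfl
      rw [image_empty, AddSubgroup.closure_empty] at ht
      have : e ∈ (⊥ : AddSubgroup (Fin (r + 1) → ℤ)) := by simp [ht]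
      rw [AddSubgroup.mem_bot] at this
      simp [this] at hfe
    have key : ∀ t : ι → Fin (r + 1) → ℤ, AddSubgroup.closure (t '' S) = ⊤ →
        ∃ t2, NielsenEquiv S t t2 ∧ t2 i = e ∧ (∀ l ∈ S, l ≠ i → f (t2 l) = 0) ∧
          AddSubgroup.closure ((fun l => Fin.tail (t2 l)) '' (S \ {i})) = ⊤ := by
      intro t ht
      obtain ⟨t1, h1, h1i, h1o⟩ := NielsenEquiv.exists_eq_one f hi t
        fun c hc => isUnit_of_dvd_of_closure_eq_top ht f hfe hc
      have ht1 : ∀ v, f v = 0 → v ∈ AddSubgroup.closure (t1 '' (S \ {i})) := fun v hv =>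
        mem_closure_diff_of_map_eq_zero f h1i h1o (by simp [← h1.closure_eq, ht]) hv
      have h2 := NielsenEquiv.add_mem_closure hi (ht1 (e - t1 i) (by rw [map_sub, hfe, h1i]; rfl))
      rw [add_sub_cancel] at h2
      refine ⟨_, h1.trans h2, by simp, fun l hl hli => by simpa [hli] using h1o l hl hli, ?_⟩
      rw [eq_top_iff]
      rintro w -
      set π : (Fin (r + 1) → ℤ) →+ (Fin r → ℤ) :=
        { toFun := Fin.tail, map_zero' := rfl, map_add' := fun _ _ => rfl } with hπ
      have hw := AddSubgroup.mem_map_of_mem π (ht1 (Fin.cons 0 w) (by simp [hf]))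
      rw [AddMonoidHom.map_closure, image_image] at hw
      have e1 : π (Fin.cons 0 w) = w := Fin.tail_cons (α := fun _ => ℤ) 0 w
      rw [e1] at hw
      convert hw using 2
      refine image_congr fun l hl => ?_
      rw [Function.update_of_ne hl.2]
      rfl
    obtain ⟨s, hs, hsi, hso, hsc⟩ := key t ht
    obtain ⟨s', hs', hsi', hso', hsc'⟩ := key t' ht'
    have hoff : ∀ l, l ∉ S → s l = s' l := fun l hl => by
      rw [← hs.eq_of_notMem hl, ← hs'.eq_of_notMem hl, heq l hl]
    have hn := ih (S \ {i}) (fun l => Fin.tail (s l)) (fun l => Fin.tail (s' l)) hsc hsc'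
      (fun l hl => by
        rcases eq_or_ne l i with rfl | hli
        · rw [hsi, hsi']
        · rw [hoff l fun h => hl ⟨h, hli⟩])
    set φ : (Fin r → ℤ) →+ (Fin (r + 1) → ℤ) :=
      { toFun := fun w => (Fin.cons 0 w : Fin (r + 1) → ℤ)
        map_zero' := by ext m; refine Fin.cases ?_ (fun _ => ?_) m <;> simp
        map_add' := fun a b => by ext m; refine Fin.cases ?_ (fun _ => ?_) m <;> simp } with hφ
    have hφt : ∀ v : Fin (r + 1) → ℤ, f v = 0 → φ (Fin.tail v) = v := fun v hv => by
      have : (Fin.cons (v 0) (Fin.tail v) : Fin (r + 1) → ℤ) = v := Fin.cons_self_tail v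
      conv_rhs => rw [← this, show v 0 = 0 from hv]
      rfl
    have hm : NielsenEquiv S s s' := by
      convert ((hn.map φ).congr s).mono sdiff_subset using 1
      · ext1 l
        split_ifs with hl
        · exact (hφt _ (hso l hl.1 hl.2)).symm
        · rfl
      · ext1 l
        split_ifs with hl
        · exact (hφt _ (hso' l hl.1 hl.2)).symm
        · rcases eq_or_ne l i with rfl | hli
          · rw [hsi, hsi']
          · exact (hoff l fun h => hl ⟨h, hli⟩).symm
    exact hs.trans (hm.trans hs'.symm)

/-- Generating tuples of a finitely generated free abelian group are Nielsen equivalent. -/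
lemma nielsenEquiv_of_closure_eq_top {V : Type*} [AddCommGroup V] [Module.Free ℤ V]
    [Module.Finite ℤ V] (S : Set ι) (t t' : ι → V)
    (ht : AddSubgroup.closure (t '' S) = ⊤) (ht' : AddSubgroup.closure (t' '' S) = ⊤)
    (heq : ∀ l, l ∉ S → t l = t' l) : NielsenEquiv S t t' := by
  set φ : V ≃+ (Fin (Module.finrank ℤ V) → ℤ) := (Module.finBasis ℤ V).equivFun.toAddEquiv
  have hc : ∀ t : ι → V, AddSubgroup.closure (t '' S) = ⊤ →
      AddSubgroup.closure ((fun l => φ (t l)) '' S) = ⊤ := fun t ht => by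
    have : (fun l => φ (t l)) '' S = φ.toAddMonoidHom '' (t '' S) := by
      rw [image_image]; rfl
    rw [this, ← AddMonoidHom.map_closure, ht, ← AddMonoidHom.range_eq_map]
    exact AddMonoidHom.range_eq_top.2 φ.surjective
  have h := nielsenEquiv_of_closure_eq_top_fin _ S _ _ (hc t ht) (hc t' ht')
    fun l hl => by rw [heq l hl]
  simpa using h.map φ.symm.toAddMonoidHom

/-- Tuples that generate the same subgroup of a torsion-free group are Nielsen equivalent. -/
lemma nielsenEquiv_of_closure_eq {d d' : ι → ℝ}
    (h : AddSubgroup.closure (range d) = AddSubgroup.closure (range d')) :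
    NielsenEquiv univ d d' := by
  set Γ := AddSubgroup.closure (range d) with hΓ
  have hm : ∀ l, d l ∈ Γ := fun l => AddSubgroup.subset_closure (mem_range_self l)
  have hm' : ∀ l, d' l ∈ Γ := fun l => h ▸ AddSubgroup.subset_closure (mem_range_self l)
  have hgen : ∀ (u : ι → ℝ) (hu : ∀ l, u l ∈ Γ), Γ = AddSubgroup.closure (range u) →
      AddSubgroup.closure ((fun l => (⟨u l, hu l⟩ : Γ)) '' univ) = ⊤ := by
    intro u hu hcl
    rw [image_univ]
    apply AddSubgroup.map_injective Γ.subtype_injective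
    rw [AddMonoidHom.map_closure, ← range_comp, ← AddMonoidHom.range_eq_map,
      AddSubgroup.range_subtype]
    exact hcl.symm
  have hfg : AddGroup.FG Γ := by
    rw [AddGroup.fg_iff_addSubgroup_fg, AddSubgroup.fg_iff]
    exact ⟨range d, rfl, finite_range d⟩
  have : Module.Finite ℤ Γ := Module.Finite.iff_addGroup_fg.2 hfg
  have : Module.Free ℤ Γ := Module.free_of_finite_type_torsion_free'
  have := nielsenEquiv_of_closure_eq_top univ _ _ (hgen d hm hΓ) (hgen d' hm' h)
    (fun l hl => absurd (mem_univ l) hl)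
  exact this.map Γ.subtype

end generation

/-! ### Moves between positive tuples of bounded sum, and reduction modulo a marked entry. -/

lemma sum_le_of_forall_le {ι : Type*} [Fintype ι] {B : ℝ} {d : ι → ℝ} {x : ℝ} (hx : Fintype.card ι * x ≤ B) (h : ∀ l, d l ≤ x) :
    ∑ l, d l ≤ B := by
  refine (Finset.sum_le_card_nsmul _ _ x fun l _ => h l).trans ?_
  simpa using hx

section linked

variable {ι : Type*} [DecidableEq ι]

/-- The tuple `t` with all components but `t i` reduced to `(0, t i]` modulo `t i`. -/
def wrap (t : ι → ℝ) (i : ι) (h : 0 < t i) : ι → ℝ :=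
  fun l => if l = i then t i else toIocMod h 0 (t l)

variable {B : ℝ} {d d' d'' : ι → ℝ}

lemma wrap_self (t : ι → ℝ) (i : ι) (h : 0 < t i) : wrap t i h i = t i := by simp [wrap]

lemma wrap_of_ne (t : ι → ℝ) {i l : ι} (h : 0 < t i) (hl : l ≠ i) :
    wrap t i h l = toIocMod h 0 (t l) := by simp [wrap, hl]

lemma wrap_pos (t : ι → ℝ) (i : ι) (h : 0 < t i) (l : ι) : 0 < wrap t i h l := by
  by_cases hl : l = i
  · rw [hl, wrap_self]; exact h
  · rw [wrap_of_ne t h hl]; exact left_lt_toIocMod h 0 _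

lemma wrap_le (t : ι → ℝ) (i : ι) (h : 0 < t i) (l : ι) : wrap t i h l ≤ t i := by
  by_cases hl : l = i
  · rw [hl, wrap_self]
  · rw [wrap_of_ne t h hl]; simpa using toIocMod_le_right h 0 (t l)

lemma wrap_congr {t t' : ι → ℝ} {i : ι} (h : 0 < t i) (h' : 0 < t' i) (hi : t' i = t i)
    (hz : ∀ l, l ≠ i → ∃ m : ℤ, t' l = t l + m * t i) : wrap t i h = wrap t' i h' := by
  ext l
  by_cases hl : l = i
  · rw [hl, wrap_self, wrap_self, hi]
  · obtain ⟨m, hm⟩ := hz l hl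
    rw [wrap_of_ne t h hl, wrap_of_ne t' h' hl, hm]
    simp only [hi]
    rw [← zsmul_eq_mul, toIocMod_add_zsmul]

lemma update_pos {i : ι} {v : ℝ} (hv : 0 < v) (hd : ∀ l, 0 < d l) (l : ι) :
    0 < Function.update d i v l := by
  by_cases hl : l = i
  · subst hl; simpa using hv
  · simpa [hl] using hd l

variable [Fintype ι]

lemma sum_update_le {i : ι} {v : ℝ} (hv : v ≤ d i) (hB : ∑ l, d l ≤ B) :
    ∑ l, Function.update d i v l ≤ B := by
  refine (Finset.sum_le_sum fun l _ => ?_).trans hB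
  by_cases hl : l = i
  · subst hl; simpa using hv
  · simp [hl]

/-- Additions of one component to another and permutations of the components, for positive tuples
of sum at most `B`. -/
inductive LinkStep (B : ℝ) : (ι → ℝ) → (ι → ℝ) → Prop
  | add (d : ι → ℝ) (i j : ι) (hij : i ≠ j) (hd : ∀ l, 0 < d l)
      (hB : ∑ l, Function.update d i (d i + d j) l ≤ B) :
      LinkStep B d (Function.update d i (d i + d j))
  | perm (d : ι → ℝ) (σ : Equiv.Perm ι) (hd : ∀ l, 0 < d l) (hB : ∑ l, d l ≤ B) :
      LinkStep B d (fun l => d (σ l))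

/-- The equivalence relation generated by `LinkStep`. -/
def Linked (B : ℝ) : (ι → ℝ) → (ι → ℝ) → Prop := Relation.EqvGen (LinkStep B)

namespace Linked

lemma refl (d : ι → ℝ) : Linked B d d := Relation.EqvGen.refl d

lemma symm (h : Linked B d d') : Linked B d' d := Relation.EqvGen.symm _ _ h

lemma trans (h : Linked B d d') (h' : Linked B d' d'') : Linked B d d'' :=
  Relation.EqvGen.trans _ _ _ h h'

lemma of_eq (h : d = d') : Linked B d d' := h ▸ refl d

lemma perm (σ : Equiv.Perm ι) (hd : ∀ l, 0 < d l) (hB : ∑ l, d l ≤ B) :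
    Linked B d (fun l => d (σ l)) := Relation.EqvGen.rel _ _ (.perm d σ hd hB)

lemma add {i j : ι} (hij : i ≠ j) (hd : ∀ l, 0 < d l) {v : ℝ} (hv : d i + d j = v)
    (hB : ∑ l, Function.update d i v l ≤ B) : Linked B d (Function.update d i v) := by
  subst hv
  exact Relation.EqvGen.rel _ _ (.add d i j hij hd hB)

lemma sub {i j : ι} (hij : i ≠ j) (hd : ∀ l, 0 < d l) (hB : ∑ l, d l ≤ B) {v : ℝ}
    (hv : d i - d j = v) (hpos : 0 < v) : Linked B d (Function.update d i v) := by
  have h := add (d := Function.update d i v) (B := B) hij (update_pos hpos hd) (v := d i)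
    (by simp [hij.symm, ← hv])
  simp only [Function.update_idem, Function.update_eq_self] at h
  exact (h hB).symm

lemma sub_nat {i j : ι} (hij : i ≠ j) (hd : ∀ l, 0 < d l) (hB : ∑ l, d l ≤ B) (m : ℕ)
    (hpos : 0 < d i - m * d j) : Linked B d (Function.update d i (d i - m * d j)) := by
  induction m with
  | zero => simpa using refl d
  | succ m ih =>
    push_cast at hpos ⊢
    have hj := hd j
    have h1 : 0 < d i - m * d j := by linarith
    refine (ih h1).trans ?_
    have h2 := sub (d := Function.update d i (d i - m * d j)) (B := B) hij (update_pos h1 hd)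
      (sum_update_le (by nlinarith [m.cast_nonneg (α := ℝ)]) hB)
      (v := d i - (m + 1) * d j) (by simp [hij.symm]; ring) hpos
    simpa using h2

end Linked

lemma exists_toIocMod_eq_sub {x y : ℝ} (hx : 0 < x) (hy : 0 < y) :
    ∃ m : ℕ, toIocMod hx 0 y = y - m * x := by
  have h := toIocMod_add_toIocDiv_zsmul hx 0 y
  have h1 := toIocMod_le_right hx 0 y
  rw [zsmul_eq_mul] at h
  have h2 : 0 ≤ toIocDiv hx 0 y := by
    by_contra! hneg
    have : (toIocDiv hx 0 y : ℝ) ≤ -1 := by exact_mod_cast Int.le_sub_one_of_lt hneg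
    nlinarith
  obtain ⟨m, hm⟩ := Int.eq_ofNat_of_zero_le h2
  refine ⟨m, ?_⟩
  rw [hm] at h
  push_cast at h
  linarith

/-- The entries are positive, so reducing them only subtracts copies of `d j`, and no sum increases.
-/
lemma linked_wrap {j : ι} (hd : ∀ l, 0 < d l) (hB : ∑ l, d l ≤ B) :
    Linked B d (wrap d j (hd j)) := by
  have hpos : ∀ l, 0 < toIocMod (hd j) 0 (d l) := fun l => left_lt_toIocMod _ _ _
  have key : ∀ F : Finset ι, Linked B d
      (fun l => if l ∈ F ∧ l ≠ j then toIocMod (hd j) 0 (d l) else d l) := by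
    intro F
    induction F using Finset.induction_on with
    | empty => simpa using Linked.refl d
    | insert a F ha ih =>
      by_cases haj : a = j
      · refine ih.trans (Linked.of_eq ?_)
        ext l
        by_cases hl : l = a
        · subst hl; simp [haj]
        · simp [hl]
      refine ih.trans ?_
      set e : ι → ℝ := fun l => if l ∈ F ∧ l ≠ j then toIocMod (hd j) 0 (d l) else d l with he
      have hepos : ∀ l, 0 < e l := fun l => by
        simp only [he]; split_ifs
        exacts [hpos l, hd l]
      have hele : ∑ l, e l ≤ B := by
        refine (Finset.sum_le_sum fun l _ => ?_).trans hB
        simp only [he]; split_ifs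
        · obtain ⟨m, hm⟩ := exists_toIocMod_eq_sub (hd j) (hd l)
          rw [hm]
          have := mul_nonneg m.cast_nonneg (hd j).le
          linarith
        · rfl
      obtain ⟨m, hm⟩ := exists_toIocMod_eq_sub (hd j) (hd a)
      have hea : e a = d a := by simp [he, ha]
      have hej : e j = d j := by simp [he]
      have h := Linked.sub_nat haj hepos hele m (by rw [hea, hej, ← hm]; exact hpos a)
      rw [hea, hej, ← hm] at h
      refine h.trans (Linked.of_eq ?_)
      ext l
      by_cases hl : l = a
      · subst hl; simp [haj]
      · simp [he, hl]
  refine (key Finset.univ).trans (Linked.of_eq ?_)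
  ext l
  by_cases hl : l = j
  · simp [wrap, hl]
  · simp [wrap, hl]

lemma linked_wrap_update_add {t : ι → ℝ} {i j l : ι} (h : 0 < t i) (hj : j ≠ i) (hl : l ≠ i)
    (hjl : j ≠ l) (h' : 0 < Function.update t j (t j + t l) i) (hB : Fintype.card ι * t i ≤ B) :
    Linked B (wrap t i h) (wrap (Function.update t j (t j + t l)) i h') := by
  set e := wrap t i h with he
  have hpos := wrap_pos t i h
  have hle := wrap_le t i h
  rw [← he] at hpos hle
  have hei : e i = t i := wrap_self t i h
  obtain ⟨v, hv, hvle, m, hm⟩ : ∃ v : ℝ, 0 < v ∧ v ≤ t i ∧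
      ∃ m : ℤ, t j + t l = v + m * t i := by
    refine ⟨toIocMod h 0 (t j + t l), left_lt_toIocMod h 0 _, ?_, toIocDiv h 0 (t j + t l), ?_⟩
    · simpa using toIocMod_le_right h 0 (t j + t l)
    · rw [← zsmul_eq_mul, toIocMod_add_toIocDiv_zsmul]
  have htgt : ∀ v : ℝ, 0 < v → v ≤ t i → (∃ m : ℤ, t j + t l = v + m * t i) →
      wrap (Function.update t j (t j + t l)) i h' = Function.update e j v := by
    intro v hv hvle ⟨m, hm⟩
    have hti : Function.update t j (t j + t l) i = t i := Function.update_of_ne hj.symm _ _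
    ext n
    by_cases hn : n = i
    · rw [hn, wrap_self, hti, Function.update_of_ne hj.symm, hei]
    rw [wrap_of_ne _ _ hn]
    simp only [hti]
    by_cases hnj : n = j
    · rw [hnj, Function.update_self, Function.update_self, toIocMod_eq_iff]
      exact ⟨⟨hv, by simpa using hvle⟩, m, by rw [zsmul_eq_mul]; exact hm⟩
    · rw [Function.update_of_ne hnj, Function.update_of_ne hnj, he, wrap_of_ne t h hn]
  obtain ⟨mj, hmj⟩ : ∃ m : ℤ, t j = e j + m * t i :=
    ⟨toIocDiv h 0 (t j), by rw [he, wrap_of_ne t h hj, ← zsmul_eq_mul,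
      toIocMod_add_toIocDiv_zsmul]⟩
  obtain ⟨ml, hml⟩ : ∃ m : ℤ, t l = e l + m * t i :=
    ⟨toIocDiv h 0 (t l), by rw [he, wrap_of_ne t h hl, ← zsmul_eq_mul,
      toIocMod_add_toIocDiv_zsmul]⟩
  have hsum : ∑ n, e n ≤ B := sum_le_of_forall_le hB hle
  -- If the sum fits below `t i`, it is a single addition. Otherwise that addition could exceed `B`;
  -- instead the marked entry is lowered to `t i - e l`, subtracted from the entry at `j`, and
  -- restored by adding `e l` back.
  rcases le_or_gt (e j + e l) (t i) with hc | hc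
  · rw [htgt (e j + e l) (add_pos (hpos j) (hpos l)) hc
      ⟨mj + ml, by rw [hmj, hml]; push_cast; ring⟩]
    refine Linked.add hjl hpos rfl (sum_le_of_forall_le hB fun n => ?_)
    by_cases hn : n = j
    · subst hn; simpa using hc
    · simpa [hn] using hle n
  rw [htgt (e j + e l - t i) (by linarith) (by linarith [hle j, hle l])
      ⟨mj + ml + 1, by rw [hmj, hml]; push_cast; ring⟩]
  rcases (hle l).eq_or_lt with hel | hel
  · rw [hel, add_sub_cancel_right, Function.update_eq_self]
    exact Linked.refl _
  have hx : 0 < t i - e l := by linarith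
  have hy : 0 < e j + e l - t i := by linarith
  have h1 : Linked B e (Function.update e i (t i - e l)) :=
    Linked.sub hl.symm hpos hsum (by rw [hei]) hx
  have hpos1 : ∀ n, 0 < Function.update e i (t i - e l) n := update_pos hx hpos
  have hsum1 : ∑ n, Function.update e i (t i - e l) n ≤ B :=
    sum_update_le (by rw [hei]; linarith [hpos l]) hsum
  have h2 : Linked B (Function.update e i (t i - e l))
      (Function.update (Function.update e i (t i - e l)) j (e j + e l - t i)) :=
    Linked.sub hj hpos1 hsum1 (by rw [Function.update_of_ne hj, Function.update_self]; ring) hy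
  have h3 : Linked B (Function.update e j (e j + e l - t i))
      (Function.update (Function.update e j (e j + e l - t i)) i (t i - e l)) := by
    refine Linked.sub hl.symm (update_pos hy hpos) (sum_update_le (by linarith) hsum) ?_ hx
    rw [Function.update_of_ne hj.symm, Function.update_of_ne hjl.symm, hei]
  rw [Function.update_comm hj.symm] at h2
  exact h1.trans (h2.trans h3.symm)

lemma linked_wrap_update_neg {t : ι → ℝ} {i j : ι} (h : 0 < t i) (hj : j ≠ i)
    (h' : 0 < Function.update t j (-t j) i) (hB : Fintype.card ι * t i ≤ B) :
    Linked B (wrap t i h) (wrap (Function.update t j (-t j)) i h') := by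
  set e := wrap t i h with he
  have hpos := wrap_pos t i h
  have hle := wrap_le t i h
  rw [← he] at hpos hle
  have hei : e i = t i := wrap_self t i h
  have htgt : ∀ v : ℝ, 0 < v → v ≤ t i → (∃ m : ℤ, -t j = v + m * t i) →
      wrap (Function.update t j (-t j)) i h' = Function.update e j v := by
    intro v hv hvle ⟨m, hm⟩
    have hti : Function.update t j (-t j) i = t i := Function.update_of_ne hj.symm _ _
    ext n
    by_cases hn : n = i
    · rw [hn, wrap_self, hti, Function.update_of_ne hj.symm, hei]
    rw [wrap_of_ne _ _ hn]
    simp only [hti]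
    by_cases hnj : n = j
    · rw [hnj, Function.update_self, Function.update_self, toIocMod_eq_iff]
      exact ⟨⟨hv, by simpa using hvle⟩, m, by rw [zsmul_eq_mul]; exact hm⟩
    · rw [Function.update_of_ne hnj, Function.update_of_ne hnj, he, wrap_of_ne t h hn]
  obtain ⟨m, hm⟩ : ∃ m : ℤ, t j = e j + m * t i :=
    ⟨toIocDiv h 0 (t j), by rw [he, wrap_of_ne t h hj, ← zsmul_eq_mul,
      toIocMod_add_toIocDiv_zsmul]⟩
  have hsum : ∑ n, e n ≤ B := sum_le_of_forall_le hB hle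
  rcases (hle j).eq_or_lt with hel | hel
  · rw [htgt (e j) (hpos j) (hle j) ⟨-m - 2, by rw [hm, hel]; push_cast; ring⟩,
      Function.update_eq_self]
    exact Linked.refl _
  have hx : 0 < t i - e j := by linarith
  rw [htgt (t i - e j) hx (by linarith [hpos j]) ⟨-m - 1, by rw [hm]; push_cast; ring⟩]
  -- The pair (t i, e j) becomes (t i - e j, e j), then (t i - e j, t i), and a swap gives the
  -- reduced negative at `j`.
  have h1 : Linked B e (Function.update e i (t i - e j)) :=
    Linked.sub hj.symm hpos hsum (by rw [hei]) hx
  have h2 : Linked B (Function.update e i (t i - e j))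
      (Function.update (Function.update e i (t i - e j)) j (t i)) := by
    refine Linked.add hj (update_pos hx hpos)
      (by rw [Function.update_of_ne hj, Function.update_self]; ring)
      (sum_le_of_forall_le hB fun n => ?_)
    by_cases hn : n = j
    · subst hn; simp
    by_cases hni : n = i
    · subst hni; simp [hn, (hpos j).le]
    · simpa [hn, hni] using hle n
  have h3 : Linked B (Function.update e j (t i - e j))
      (fun n => Function.update e j (t i - e j) (Equiv.swap i j n)) := by
    refine Linked.perm _ (update_pos hx hpos) (sum_le_of_forall_le hB fun n => ?_)
    by_cases hn : n = j
    · subst hn; simp [(hpos n).le]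
    · simpa [hn] using hle n
  refine h1.trans (h2.trans (Linked.symm (h3.trans (Linked.of_eq ?_))))
  ext n
  by_cases hn : n = j
  · subst hn; simp [hei, hj.symm]
  by_cases hni : n = i
  · subst hni; simp [hn]
  · simp [hn, hni, Equiv.swap_apply_of_ne_of_ne hni hn]

lemma linked_wrap_of_nielsenEquiv {t t' : ι → ℝ} {i : ι} (hN : NielsenEquiv {i}ᶜ t t')
    (h : 0 < t i) (h' : 0 < t' i) (hB : Fintype.card ι * t i ≤ B) :
    Linked B (wrap t i h) (wrap t' i h') := by
  induction hN with
  | rel t t' hs =>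
    cases hs with
    | add j l hj hl hjl => exact linked_wrap_update_add h hj hl hjl h' hB
    | neg j hj => exact linked_wrap_update_neg h hj h' hB
  | refl t => exact Linked.refl _
  | symm t t' hs ih =>
    have e : t i = t' i := NielsenEquiv.eq_of_notMem hs (by simp)
    exact (ih h' h (by rwa [e])).symm
  | trans t s t' hs _ ih ih' =>
    have e : t i = s i := NielsenEquiv.eq_of_notMem hs (by simp)
    exact (ih h (e ▸ h) hB).trans (ih' (e ▸ h) h' (e ▸ hB))

/-- Adding multiples of the component `i` to components other than `i`. -/
lemma nielsenEquiv_add_zsmul {V : Type*} [AddCommGroup V] {S : Set ι} (t : ι → V) {i : ι}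
    (hi : i ∈ S) (m : ι → ℤ) (hmi : m i = 0) (hm : ∀ l, l ∉ S → m l = 0) :
    NielsenEquiv S t (fun l => t l + m l • t i) := by
  have key : ∀ F : Finset ι, NielsenEquiv S t (fun l => if l ∈ F then t l + m l • t i else t l) := by
    intro F
    induction F using Finset.induction_on with
    | empty => simpa using NielsenEquiv.refl t
    | insert a F ha ih =>
      refine ih.trans ?_
      set e : ι → V := fun l => if l ∈ F then t l + m l • t i else t l with he
      have hei : e i = t i := by simp [he, hmi]
      have hea : e a = t a := by simp [he, ha]
      have e1 : (fun l => if l ∈ insert a F then t l + m l • t i else t l)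
          = Function.update e a (e a + m a • t i) := by
        ext1 l
        by_cases hl : l = a
        · subst hl; simp [hea]
        · simp [he, hl]
      rw [e1]
      by_cases h0 : m a = 0
      · simpa [h0] using NielsenEquiv.refl e
      · have haS : a ∈ S := by_contra fun h => h0 (hm a h)
        have hai : i ≠ a := by rintro rfl; exact h0 hmi
        refine NielsenEquiv.add_mem_closure haS (zsmul_mem ?_ _)
        exact AddSubgroup.subset_closure ⟨i, ⟨hi, hai⟩, hei⟩
  simpa using key Finset.univ

/-- Since `t j ≤ t i`, reduction modulo `t i` keeps the entry at `j`. The tuple reduced modulo `t i`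
differs from `t` by multiples of `t i` added to entries other than `i` and `j`, which is a Nielsen
equivalence fixing the new mark `j`. -/
lemma linked_wrap_wrap {t : ι → ℝ} {i j : ι} (hi : 0 < t i) (hj : 0 < t j) (hji : t j ≤ t i)
    (hB : Fintype.card ι * t i ≤ B) : Linked B (wrap t i hi) (wrap t j hj) := by
  rcases eq_or_ne i j with rfl | hij
  · exact Linked.refl _
  set u := wrap t i hi with hu
  have huj : u j = t j := by
    rw [hu, wrap_of_ne t hi hij.symm, toIocMod_eq_self]
    exact ⟨hj, by simpa using hji⟩
  have hupos := wrap_pos t i hi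
  rw [← hu] at hupos
  have h1 := linked_wrap (j := j) hupos (sum_le_of_forall_le hB (wrap_le t i hi))
  refine h1.trans (Linked.symm ?_)
  refine linked_wrap_of_nielsenEquiv ?_ hj (hupos j)
    ((mul_le_mul_of_nonneg_left hji (Nat.cast_nonneg _)).trans hB)
  have h2 := nielsenEquiv_add_zsmul (S := {j}ᶜ) t (i := i) hij
    (fun l => if l = i ∨ l = j then 0 else -toIocDiv hi 0 (t l)) (by simp)
    (fun l hl => by simp [show l = j by simpa using hl])
  convert h2 using 1
  ext l
  by_cases hl : l = i
  · simp [hl, hu, wrap_self]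
  by_cases hl' : l = j
  · simp [hl', huj]
  · simp only [hl, hl', or_self, if_false, hu]
    rw [wrap_of_ne t hi hl, neg_zsmul, ← sub_eq_add_neg, self_sub_toIocDiv_zsmul]

end linked

/-! ### Changing the marked vector of a lattice basis. -/

section lattice

variable {ι : Type*} [DecidableEq ι] [Fintype ι] {B : ℝ}

/-- The coordinates with respect to a generating tuple of `ℤ^ι`. -/
lemma exists_coordinates {b : ι → ι → ℤ} (hb : AddSubgroup.closure (range b) = ⊤) :
    ∃ c : (ι → ℤ) ≃+ (ι → ℤ), (∀ l, c (b l) = Pi.single l 1) ∧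
      ∀ u, u = ∑ l, c u l • b l := by
  set L : (ι → ℤ) →ₗ[ℤ] (ι → ℤ) := Fintype.linearCombination ℤ b with hL
  have hLs : ∀ l, L (Pi.single l 1) = b l := fun l => by simp [hL]
  have hsurj : Function.Surjective L := by
    have : (⊤ : AddSubgroup (ι → ℤ)) ≤ L.toAddMonoidHom.range := by
      rw [← hb, AddSubgroup.closure_le]
      rintro _ ⟨l, rfl⟩
      exact ⟨Pi.single l 1, hLs l⟩
    exact fun u => this (AddSubgroup.mem_top u)
  have hinj := OrzechProperty.injective_of_surjective_endomorphism L hsurj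
  set e := LinearEquiv.ofBijective L ⟨hinj, hsurj⟩ with he
  have hes : ∀ v, L (e.symm v) = v := fun v => e.apply_symm_apply v
  refine ⟨e.symm.toAddEquiv, fun l => hinj ?_, fun u => ?_⟩
  · rw [hLs]; exact hes _
  · conv_lhs => rw [← hes u]
    rw [hL, Fintype.linearCombination_apply]
    rfl

/-- Two generating tuples of `ℤ^ι` with a common element at `i` have linked images in `ℝ`. -/
lemma linked_wrap_of_closure_eq_top {b b' : ι → ι → ℤ} (hb : AddSubgroup.closure (range b) = ⊤)
    (hb' : AddSubgroup.closure (range b') = ⊤) (ψ : (ι → ℤ) →+ ℝ) {i : ι} (hi : b i = b' i)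
    (h : 0 < ψ (b i)) (h' : 0 < ψ (b' i)) (hB : Fintype.card ι * ψ (b i) ≤ B) :
    Linked B (wrap (fun l => ψ (b l)) i h) (wrap (fun l => ψ (b' l)) i h') := by
  obtain ⟨c, hc, hcu⟩ := exists_coordinates hb
  -- This is the quotient by `b i`, on which the two bases become Nielsen equivalent away from `i`.
  -- The map `ρ` below recovers `ψ` from it up to multiples of `ψ (b i)`, which `wrap` does not see.
  set π : (ι → ℤ) →+ ({l // l ≠ i} → ℤ) :=
    { toFun := fun u m => c u m, map_zero' := by ext; simp, map_add' := fun u v => by ext; simp }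
    with hπ
  set ρ : ({l // l ≠ i} → ℤ) →+ ℝ :=
    { toFun := fun g => ∑ l, ((if hl : l ≠ i then g ⟨l, hl⟩ else 0 : ℤ) : ℝ) * ψ (b l)
      map_zero' := by simp
      map_add' := fun g g' => by
        rw [← Finset.sum_add_distrib]
        refine Finset.sum_congr rfl fun l _ => ?_
        split_ifs <;> simp [add_mul] } with hρ
  have hψ : ∀ u, ψ u = ρ (π u) + (c u i : ℝ) * ψ (b i) := fun u => by
    have e1 : (c u i : ℝ) * ψ (b i) = ∑ l, if l = i then (c u l : ℝ) * ψ (b l) else 0 := by simp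
    have e2 : ψ u = ∑ l, (c u l : ℝ) * ψ (b l) := by
      conv_lhs => rw [hcu u]
      simp only [map_sum, map_zsmul]
      simp only [zsmul_eq_mul]
    rw [e1, e2]
    simp only [hρ, hπ, AddMonoidHom.coe_mk, ZeroHom.coe_mk]
    rw [← Finset.sum_add_distrib]
    refine Finset.sum_congr rfl fun l _ => ?_
    by_cases hl : l = i <;> simp [hl]
  have hπi : π (b i) = 0 := by
    ext m
    simp [hπ, hc, m.2]
  have hsurj : Function.Surjective π := fun g => by
    refine ⟨c.symm fun l => if hl : l ≠ i then g ⟨l, hl⟩ else 0, ?_⟩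
    ext m
    simp [hπ, m.2]
  have hgen : ∀ b'' : ι → ι → ℤ, AddSubgroup.closure (range b'') = ⊤ → π (b'' i) = 0 →
      AddSubgroup.closure ((fun l => π (b'' l)) '' {i}ᶜ) = ⊤ := by
    intro b'' hb'' h0
    have e : AddSubgroup.closure (π '' range b'') = ⊤ := by
      rw [← AddMonoidHom.map_closure, hb'', ← AddMonoidHom.range_eq_map]
      exact AddMonoidHom.range_eq_top.2 hsurj
    rw [eq_top_iff, ← e, AddSubgroup.closure_le]
    rintro _ ⟨_, ⟨l, rfl⟩, rfl⟩
    by_cases hl : l = i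
    · rw [hl, h0]; exact zero_mem _
    · exact AddSubgroup.subset_closure ⟨l, hl, rfl⟩
  have hN := nielsenEquiv_of_closure_eq_top {i}ᶜ _ _ (hgen b hb hπi) (hgen b' hb' (hi ▸ hπi))
    (fun l hl => by
      have : l = i := by simpa using hl
      rw [this, hi])
  have hN' := (hN.map ρ).congr (fun l => ψ (b l))
  refine (Linked.of_eq ?_).trans ((linked_wrap_of_nielsenEquiv hN' (i := i) (by simpa using h)
    (by simpa using h) (by simpa using hB)).trans (Linked.of_eq ?_))
  · refine wrap_congr _ _ (by simp) fun l hl => ⟨-c (b l) i, ?_⟩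
    simp only [mem_compl_iff, mem_singleton_iff, hl, not_false_eq_true, if_true]
    rw [hψ (b l)]
    push_cast
    ring
  · refine wrap_congr _ _ (by simp [hi]) fun l hl => ⟨c (b' l) i, ?_⟩
    simp only [mem_compl_iff, mem_singleton_iff, hl, not_false_eq_true, if_true, not_true,
      if_false]
    exact hψ (b' l)

lemma closure_range_single :
    AddSubgroup.closure (range fun l : ι => (Pi.single l 1 : ι → ℤ)) = ⊤ := by
  rw [eq_top_iff]
  rintro u -
  have : u = ∑ l, u l • (Pi.single l 1 : ι → ℤ) := by
    ext m
    simp [Finset.sum_apply, Pi.single_apply]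
  rw [this]
  exact sum_mem fun l _ => zsmul_mem (AddSubgroup.subset_closure (mem_range_self l)) _

/-- With two coordinates besides `i` there is a functional `ζ` killing both e_i and `τ i` and taking
the value 1 at some `z`. Then `z` lies in a basis with e_i and in a basis with `τ i`, and the mark
passes from e_i to `z` and on to `τ i`. -/
lemma linked_of_three {i j l : ι} (hji : j ≠ i) (hli : l ≠ i) (hjl : j ≠ l)
    {τ : ι → ι → ℤ} (hτ : AddSubgroup.closure (range τ) = ⊤) (ψ : (ι → ℤ) →+ ℝ)
    (hx : 0 < ψ (Pi.single i 1)) (hxy : ψ (Pi.single i 1) ≤ ψ (τ i))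
    (hB : Fintype.card ι * ψ (τ i) ≤ B) :
    Linked B (wrap (fun m => ψ (Pi.single m 1)) i hx)
      (wrap (fun m => ψ (τ m)) i (hx.trans_le hxy)) := by
  set x := ψ (Pi.single i 1) with hxdef
  have hle : ∀ v, v ≤ ψ (τ i) → Fintype.card ι * v ≤ B := fun v hv =>
    (mul_le_mul_of_nonneg_left hv (Nat.cast_nonneg _)).trans hB
  -- The primitive vector (p, q) is the direction of `τ i` in the coordinates `j`, `l`; any
  -- primitive vector serves when both coordinates vanish.
  obtain ⟨g, p, q, hp, hq, α, β, hαβ⟩ : ∃ g p q : ℤ, τ i j = g * p ∧ τ i l = g * q ∧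
      ∃ α β : ℤ, α * p + β * q = 1 := by
    by_cases h0 : τ i j = 0 ∧ τ i l = 0
    · exact ⟨0, 1, 0, by simp [h0.1], by simp [h0.2], 1, 0, by simp⟩
    · have hg : 0 < Int.gcd (τ i j) (τ i l) := Int.gcd_pos_iff.2 (by tauto)
      have := Int.isCoprime_iff_gcd_eq_one.2 (Int.gcd_div_gcd_div_gcd hg)
      obtain ⟨α, β, h⟩ := this
      refine ⟨Int.gcd (τ i j) (τ i l), _, _, ?_, ?_, α, β, h⟩
      · rw [Int.mul_ediv_cancel' (Int.gcd_dvd_left ..)]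
      · rw [Int.mul_ediv_cancel' (Int.gcd_dvd_right ..)]
  set e : ι → ι → ℤ := fun m => Pi.single m 1 with he
  set z0 : ι → ℤ := -β • e j + α • e l with hz0
  -- Subtracting a multiple of e_i does not affect `ζ`, and brings the value of `ψ` into (0, x], so
  -- that `z` is admissible as a mark.
  set z : ι → ℤ := z0 - toIocDiv hx 0 (ψ z0) • e i with hz
  have hψz : ψ z = toIocMod hx 0 (ψ z0) := by
    rw [hz, map_sub, map_zsmul, ← self_sub_toIocDiv_zsmul]
  have hzpos : 0 < ψ z := by rw [hψz]; exact left_lt_toIocMod hx 0 _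
  have hzle : ψ z ≤ x := by rw [hψz]; simpa using toIocMod_le_right hx 0 (ψ z0)
  set ζ : (ι → ℤ) →+ ℤ :=
    { toFun := fun v => -q * v j + p * v l, map_zero' := by simp
      map_add' := fun u v => by simp; ring } with hζ
  have hζe : ∀ m, ζ (e m) = -q * (e m j) + p * e m l := fun m => rfl
  have hζi : ζ (e i) = 0 := by rw [hζe]; simp [he, hji, hli]
  have hζz : ζ z = 1 := by
    rw [hz, hz0, map_sub, map_add, map_zsmul, map_zsmul, map_zsmul, hζi, hζe, hζe]
    simp [he, hjl, hjl.symm]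
    linear_combination hαβ
  have hζτ : ζ (τ i) = 0 := by
    change -q * τ i j + p * τ i l = 0
    rw [hp, hq]; ring
  set s : ι → ι → ℤ := Function.update (Function.update e j (p • e j + q • e l)) l z with hs
  have hsi : s i = e i := by simp [hs, hli.symm, hji.symm]
  have hsl : s l = z := by simp [hs]
  have hsj : s j = p • e j + q • e l := by simp [hs, hjl]
  have hsgen : AddSubgroup.closure (range s) = ⊤ := by
    have hm : ∀ m, s m ∈ AddSubgroup.closure (range s) := fun m =>
      AddSubgroup.subset_closure (mem_range_self m)
    have hz0m : z0 ∈ AddSubgroup.closure (range s) := by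
      have : z0 = s l + toIocDiv hx 0 (ψ z0) • s i := by rw [hsl, hsi, hz]; abel
      rw [this]
      exact add_mem (hm l) (zsmul_mem (hm i) _)
    have hej : e j = α • s j - q • z0 := by
      rw [hsj, hz0]
      have : e j = (α * p + β * q) • e j := by rw [hαβ, one_smul]
      refine this.trans ?_
      module
    have hel : e l = β • s j + p • z0 := by
      rw [hsj, hz0]
      have : e l = (α * p + β * q) • e l := by rw [hαβ, one_smul]
      refine this.trans ?_
      module
    rw [eq_top_iff, ← closure_range_single, AddSubgroup.closure_le]
    rintro _ ⟨m, rfl⟩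
    change e m ∈ AddSubgroup.closure (range s)
    by_cases hmj : m = j
    · rw [hmj, hej]; exact sub_mem (zsmul_mem (hm j) _) (zsmul_mem hz0m _)
    by_cases hml : m = l
    · rw [hml, hel]; exact add_mem (zsmul_mem (hm j) _) (zsmul_mem hz0m _)
    · have : s m = e m := by simp [hs, hmj, hml]
      rw [← this]; exact hm m
  obtain ⟨τ', hτ', hτ'l, hτ'o⟩ := NielsenEquiv.exists_eq_one ζ (S := {i}ᶜ) (i := l) hli τ
    (fun c hc => isUnit_of_dvd_of_closure_eq_top (S := univ) (t := τ)
      (by rw [image_univ, hτ]) ζ hζz fun m _ => by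
        by_cases hm : m = i
        · rw [hm, hζτ]; exact dvd_zero _
        · exact hc m hm)
  have hτ'i : τ i = τ' i := hτ'.eq_of_notMem (by simp)
  have hτ'gen : AddSubgroup.closure (τ' '' univ) = ⊤ := by
    rw [← (hτ'.mono (subset_univ _)).closure_eq, image_univ, hτ]
  -- In `τ'` only the entry at `l` has nonzero `ζ`, namely 1, so `z` may replace it and the tuple
  -- still generates.
  set σ : ι → ι → ℤ := Function.update τ' l z with hσ
  have hσi : σ i = τ i := by simp [hσ, hli.symm, hτ'i]
  have hσl : σ l = z := by simp [hσ]
  have hσgen : AddSubgroup.closure (range σ) = ⊤ := by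
    have hm : ∀ m, σ m ∈ AddSubgroup.closure (range σ) := fun m =>
      AddSubgroup.subset_closure (mem_range_self m)
    have hker : τ' l - z ∈ AddSubgroup.closure (τ' '' (univ \ {l})) := by
      refine mem_closure_diff_of_map_eq_zero ζ hτ'l (fun m _ hml => ?_)
        (by rw [hτ'gen]; exact AddSubgroup.mem_top _)
        (by rw [map_sub, hτ'l, hζz, sub_self])
      by_cases hmi : m = i
      · rw [hmi, ← hτ'i, hζτ]
      · exact hτ'o m hmi hml
    have hsub : AddSubgroup.closure (τ' '' (univ \ {l})) ≤ AddSubgroup.closure (range σ) := by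
      rw [AddSubgroup.closure_le]
      rintro _ ⟨m, ⟨-, hml⟩, rfl⟩
      have : σ m = τ' m := Function.update_of_ne hml _ _
      rw [← this]; exact hm m
    rw [eq_top_iff, ← hτ'gen, AddSubgroup.closure_le]
    rintro _ ⟨m, -, rfl⟩
    by_cases hml : m = l
    · have h1 := add_mem (hsub hker) (hm l)
      rwa [hσl, sub_add_cancel, ← hml] at h1
    · have : σ m = τ' m := Function.update_of_ne hml _ _
      rw [← this]; exact hm m
  have hy : 0 < ψ (τ i) := hx.trans_le hxy
  have c1 : Linked B (wrap (fun m => ψ (e m)) i hx)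
      (wrap (fun m => ψ (s m)) i (by rw [hsi]; exact hx)) :=
    linked_wrap_of_closure_eq_top closure_range_single hsgen ψ hsi.symm hx _ (hle _ hxy)
  have c2 : Linked B (wrap (fun m => ψ (s m)) i (by rw [hsi]; exact hx))
      (wrap (fun m => ψ (s m)) l (by rw [hsl]; exact hzpos)) :=
    linked_wrap_wrap _ _ (by simp only [hsi, hsl]; exact hzle) (by simp only [hsi]; exact hle _ hxy)
  have c3 : Linked B (wrap (fun m => ψ (s m)) l (by rw [hsl]; exact hzpos))
      (wrap (fun m => ψ (σ m)) l (by rw [hσl]; exact hzpos)) :=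
    linked_wrap_of_closure_eq_top hsgen hσgen ψ (hsl.trans hσl.symm) _ _
      (by rw [hsl]; exact hle _ (hzle.trans hxy))
  have c4 : Linked B (wrap (fun m => ψ (σ m)) i (by rw [hσi]; exact hy))
      (wrap (fun m => ψ (σ m)) l (by rw [hσl]; exact hzpos)) :=
    linked_wrap_wrap _ _ (by simp only [hσi, hσl]; exact hzle.trans hxy)
      (by simp only [hσi]; exact hB)
  have c5 : Linked B (wrap (fun m => ψ (σ m)) i (by rw [hσi]; exact hy))
      (wrap (fun m => ψ (τ m)) i hy) :=
    linked_wrap_of_closure_eq_top hσgen hτ ψ hσi _ _ (by rw [hσi]; exact hB)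
  exact c1.trans (c2.trans (c3.trans (c4.symm.trans c5)))

end lattice

/-! ### Linking any two positive tuples that generate the same subgroup. -/

section linking

variable {ι : Type*} [DecidableEq ι] [Fintype ι] {B : ℝ}

lemma linked_wrap_pair {i j : ι} (hij : i ≠ j) (hu : ∀ l, l = i ∨ l = j) {t t' : ι → ℝ}
    {s m : ℤ} (hs : s = 1 ∨ s = -1) (hi : t' i = t i) (hj : t' j = s * t j + m * t i)
    (h : 0 < t i) (h' : 0 < t' i) (hB : Fintype.card ι * t i ≤ B) :
    Linked B (wrap t i h) (wrap t' i h') := by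
  rcases hs with rfl | rfl
  · refine Linked.of_eq (wrap_congr h h' hi fun l hl => ⟨m, ?_⟩)
    rw [(hu l).resolve_left hl, hj]
    push_cast; ring
  · refine (linked_wrap_update_neg h hij.symm (by simpa [hij] using h) hB).trans (Linked.of_eq ?_)
    refine wrap_congr _ h' (by simp [hij, hi]) fun l hl => ⟨m, ?_⟩
    rw [(hu l).resolve_left hl, hj]
    simp [hij]

/-- The two pairs differ by an integer matrix of determinant ±1. Induction on |β|: the larger mark
is replaced by a smaller one, as in a continued fraction, until β = 0. -/
lemma linked_of_two {i j : ι} (hij : i ≠ j) (hu : ∀ l, l = i ∨ l = j) (N : ℕ) :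
    ∀ (t t' : ι → ℝ) (α β γ δ : ℤ) (h : 0 < t i) (h' : 0 < t' i),
      Fintype.card ι * t i ≤ B → Fintype.card ι * t' i ≤ B → t' i = α * t i + β * t j →
      t' j = γ * t i + δ * t j → (α * δ - β * γ = 1 ∨ α * δ - β * γ = -1) → β.natAbs = N →
      Linked B (wrap t i h) (wrap t' i h') := by
  induction N using Nat.strong_induction_on with
  | _ N ih =>
  have key : ∀ (t t' : ι → ℝ) (α β γ δ : ℤ) (h : 0 < t i) (h' : 0 < t' i),
      Fintype.card ι * t i ≤ B → Fintype.card ι * t' i ≤ B → t' i = α * t i + β * t j →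
      t' j = γ * t i + δ * t j → (α * δ - β * γ = 1 ∨ α * δ - β * γ = -1) → β.natAbs = N →
      t i ≤ t' i → Linked B (wrap t i h) (wrap t' i h') := by
    intro t t' α β γ δ h h' hB hB' hti htj hdet hN hle
    rcases eq_or_ne β 0 with rfl | hβ
    · have hu1 : IsUnit (α * δ) := by
        rw [Int.isUnit_iff]; simpa using hdet
      have hα := Int.isUnit_iff.1 (isUnit_of_mul_isUnit_left hu1)
      have hδ := Int.isUnit_iff.1 (isUnit_of_mul_isUnit_right hu1)
      have hα1 : α = 1 := hα.resolve_right fun hα => by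
        rw [hα] at hti
        push_cast at hti
        linarith
      refine linked_wrap_pair hij hu hδ (m := γ) ?_ ?_ h h' hB
      · rw [hti, hα1]; simp
      · rw [htj]; ring
    obtain ⟨ε, hε, hdet⟩ : ∃ ε : ℤ, (ε = 1 ∨ ε = -1) ∧ α * δ - β * γ = ε := ⟨_, hdet, rfl⟩
    have hε2 : ε * ε = 1 := by rcases hε with rfl | rfl <;> norm_num
    obtain ⟨s, hs, D, hD, hDs⟩ : ∃ s : ℤ, (s = 1 ∨ s = -1) ∧ ∃ D : ℤ, 0 < D ∧ D = s * (-ε * β) := by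
      have h0 : -ε * β ≠ 0 := by rcases hε with rfl | rfl <;> simpa using hβ
      rcases h0.lt_or_gt with h0 | h0
      · exact ⟨-1, Or.inr rfl, -1 * (-ε * β), by linarith, rfl⟩
      · exact ⟨1, Or.inl rfl, 1 * (-ε * β), by linarith, rfl⟩
    have hs2 : s * s = 1 := by rcases hs with rfl | rfl <;> norm_num
    have hDN : D.natAbs = N := by
      rw [← hN, hDs]
      rcases hs with rfl | rfl <;> rcases hε with rfl | rfl <;> simp
    set r := (-(ε * δ)) % D with hr
    set q := (-(ε * δ)) / D with hq
    have hqr : D * q + r = -(ε * δ) := Int.mul_ediv_add_emod _ _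
    have hr0 : 0 ≤ r := Int.emod_nonneg _ hD.ne'
    have hrD : r < D := Int.emod_lt_of_pos _ hD
    have hdetR : (α * δ - β * γ : ℝ) = ε := by exact_mod_cast hdet
    have hε2R : (ε * ε : ℝ) = 1 := by exact_mod_cast hε2
    have hs2R : (s * s : ℝ) = 1 := by exact_mod_cast hs2
    have hDsR : (D : ℝ) = s * (-ε * β) := by exact_mod_cast hDs
    have hqrR : (D * q + r : ℝ) = -(ε * δ) := by exact_mod_cast hqr
    have hr0R : (0 : ℝ) ≤ r := by exact_mod_cast hr0
    have hrDR : (r + 1 : ℝ) ≤ D := by exact_mod_cast hrD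
    have hDR : (0 : ℝ) < D := by exact_mod_cast hD
    -- With D = |β| and r a remainder modulo D, the relation becomes t i = D g - r t' i. From 0 < t
    -- i ≤ t' i and r < D it follows that 0 < g ≤ t' i. So g can be the new mark, and the new
    -- off-diagonal coefficient -r is smaller than D.
    set g : ℝ := s * t' j - q * t' i with hg
    have hx : t i = D * g - r * t' i := by
      have e1 : t i = ε * δ * t' i - ε * β * t' j := by
        rw [hti, htj]
        linear_combination (-(ε * t i : ℝ)) * hdetR - t i * hε2R
      rw [hg]
      linear_combination e1 + hqrR * t' i - s * t' j * hDsR + ε * β * t' j * hs2R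
    have hgpos : 0 < g := by
      have : 0 < D * g := by nlinarith
      exact (pos_iff_pos_of_mul_pos this).1 hDR
    have hgle : g ≤ t' i := by
      have : D * g ≤ D * t' i := by nlinarith
      exact le_of_mul_le_mul_left this hDR
    set t2 : ι → ℝ := fun l => if l = i then t' i else g with ht2
    set t3 : ι → ℝ := fun l => if l = i then g else t' i with ht3
    have h2i : t2 i = t' i := by simp [ht2]
    have h2j : t2 j = g := by simp [ht2, hij.symm]
    have h3i : t3 i = g := by simp [ht3]
    have h3j : t3 j = t' i := by simp [ht3, hij.symm]
    have h2pos : 0 < t2 i := h2i ▸ h'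
    have h2pos' : 0 < t2 j := h2j ▸ hgpos
    have h3pos : 0 < t3 i := h3i ▸ hgpos
    have c1 : Linked B (wrap t' i h') (wrap t2 i h2pos) :=
      linked_wrap_pair hij hu hs (m := -q) h2i (by rw [h2j, hg]; push_cast; ring) h' h2pos hB'
    have c2 : Linked B (wrap t2 i h2pos) (wrap t2 j h2pos') :=
      linked_wrap_wrap _ _ (by rw [h2i, h2j]; exact hgle) (by rw [h2i]; exact hB')
    have hcg : Fintype.card ι * g ≤ B :=
      (mul_le_mul_of_nonneg_left hgle (Nat.cast_nonneg _)).trans hB'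
    have c3 : Linked B (wrap t2 j h2pos') (wrap t3 i h3pos) := by
      refine (Linked.perm (Equiv.swap i j) (wrap_pos t2 j h2pos')
        (sum_le_of_forall_le (x := t2 j) (by rw [h2j]; exact hcg) (wrap_le t2 j h2pos'))).trans
        (Linked.of_eq ?_)
      ext l
      rcases hu l with rfl | rfl
      · rw [Equiv.swap_apply_left, wrap_self, wrap_self, h2j, h3i]
      · rw [Equiv.swap_apply_right, wrap_of_ne _ _ hij, wrap_of_ne _ _ hij.symm]
        simp only [h2i, h2j, h3i, h3j]
    have c4 : Linked B (wrap t3 i h3pos) (wrap t i h) := by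
      refine ih r.natAbs (by omega) t3 t D (-r) (ε * α * s) (ε * α * s * q - ε * γ) h3pos h
        (by rw [h3i]; exact hcg) hB ?_ ?_ ?_ (by simp)
      · rw [h3i, h3j, hx]; push_cast; ring
      · rw [h3i, h3j, hg, htj]
        push_cast
        have e2 : (α * t' j - γ * t' i : ℝ) = ε * t j := by
          rw [hti, htj]; linear_combination t j * hdetR
        rw [htj] at e2
        linear_combination (-ε : ℝ) * e2 - ε * α * (γ * t i + δ * t j) * hs2R - t j * hε2R
      · have : D * (ε * α * s * q - ε * γ) - -r * (ε * α * s) = -(s * ε) := by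
          linear_combination ε * α * s * hqr - ε * γ * hDs - (α * δ * s - γ * s * β) * hε2 - s * hdet
        rw [this]
        rcases hs with rfl | rfl <;> rcases hε with rfl | rfl <;> simp
    exact (c1.trans (c2.trans (c3.trans c4))).symm
  intro t t' α β γ δ h h' hB hB' hti htj hdet hN
  rcases le_total (t i) (t' i) with hle | hle
  · exact key t t' α β γ δ h h' hB hB' hti htj hdet hN hle
  · obtain ⟨ε, hε, hdet⟩ : ∃ ε : ℤ, (ε = 1 ∨ ε = -1) ∧ α * δ - β * γ = ε := ⟨_, hdet, rfl⟩
    have hε2 : ε * ε = 1 := by rcases hε with rfl | rfl <;> norm_num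
    have hdetR : (α * δ - β * γ : ℝ) = ε := by exact_mod_cast hdet
    have hε2R : (ε * ε : ℝ) = 1 := by exact_mod_cast hε2
    refine (key t' t (ε * δ) (-ε * β) (-ε * γ) (ε * α) h' h hB' hB ?_ ?_ ?_ ?_ hle).symm
    · push_cast
      rw [hti, htj]
      linear_combination (-(ε * t i : ℝ)) * hdetR - t i * hε2R
    · push_cast
      rw [hti, htj]
      linear_combination (-(ε * t j : ℝ)) * hdetR - t j * hε2R
    · have : ε * δ * (ε * α) - -ε * β * (-ε * γ) = ε := by
        linear_combination (α * δ - β * γ) * hε2 + hdet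
      rwa [this]
    · rw [← hN]
      rcases hε with rfl | rfl <;> simp

lemma linked_of_closure_eq_of_min {d d' : ι → ℝ} (hd : ∀ l, 0 < d l) (hd' : ∀ l, 0 < d' l)
    (hB : ∑ l, d l ≤ B) (hB' : ∑ l, d' l ≤ B)
    (hcl : AddSubgroup.closure (range d) = AddSubgroup.closure (range d')) {i : ι}
    (hmin : ∀ l, d i ≤ d l) (hmin' : ∀ l, d' i ≤ d' l) (hle : d i ≤ d' i) : Linked B d d' := by
  refine (linked_wrap (j := i) hd hB).trans (Linked.trans ?_ (linked_wrap (j := i) hd' hB').symm)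
  -- Marking the minimum is what makes every reduced tuple fit into the bound.
  have hcard : ∀ d : ι → ℝ, (∀ l, d i ≤ d l) → Fintype.card ι * d i ≤ ∑ l, d l := fun d h => by
    simpa using Finset.card_nsmul_le_sum Finset.univ d (d i) fun l _ => h l
  have hc := (hcard d hmin).trans hB
  have hc' := (hcard d' hmin').trans hB'
  set ψ : (ι → ℤ) →+ ℝ :=
    { toFun := fun u => ∑ l, (u l : ℝ) * d l, map_zero' := by simp
      map_add' := fun u v => by simp [add_mul, Finset.sum_add_distrib] } with hψ
  have hψe : ∀ l, ψ (Pi.single l 1) = d l := fun l => by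
    simp [hψ, Pi.single_apply]
  -- The entries of `d` may be linearly dependent over ℤ; lifting the Nielsen moves along `ψ`
  -- provides a genuine basis `τ` of ℤ^ι above `d'`.
  obtain ⟨τ, hτN, hτ⟩ := (nielsenEquiv_of_closure_eq hcl).exists_lift ψ
    (fun l => Pi.single l 1) hψe
  have hτc : AddSubgroup.closure (range τ) = ⊤ := by
    rw [← image_univ, ← hτN.closure_eq, image_univ, closure_range_single]
  by_cases h3 : ∃ j l, j ≠ i ∧ l ≠ i ∧ j ≠ l
  · obtain ⟨j, l, hji, hli, hjl⟩ := h3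
    have := linked_of_three (B := B) hji hli hjl hτc ψ (by rw [hψe]; exact hd i)
      (by rw [hψe, hτ]; exact hle) (by rw [hτ]; exact hc')
    refine (Linked.of_eq (wrap_congr _ _ (hψe i) fun l _ => ⟨0, ?_⟩)).trans
      (this.trans (Linked.of_eq (wrap_congr _ _ (hτ i).symm fun l _ => ⟨0, ?_⟩)))
    · simp [hψe]
    · simp [hτ]
  by_cases h2 : ∃ j, j ≠ i
  · obtain ⟨j, hji⟩ := h2
    have hu : ∀ l, l = i ∨ l = j := fun l => by
      by_contra! hcon
      exact h3 ⟨l, j, hcon.1, hji, hcon.2⟩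
    have huniv : (Finset.univ : Finset ι) = {i, j} := by
      ext l; simpa using hu l
    have hsum : ∀ l, d' l = τ l i * d i + τ l j * d j := fun l => by
      rw [← hτ l]
      simp [hψ, huniv, Finset.sum_pair hji.symm]
    refine linked_of_two hji.symm hu _ d d' (τ i i) (τ i j) (τ j i) (τ j j) (hd i) (hd' i) hc hc'
      (hsum i) (hsum j) ?_ rfl
    obtain ⟨c, -, hcu⟩ := exists_coordinates hτc
    have hm : ∀ m l, (Pi.single m 1 : ι → ℤ) l
        = c (Pi.single m 1) i * τ i l + c (Pi.single m 1) j * τ j l := fun m l => by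
      conv_lhs => rw [hcu (Pi.single m 1)]
      simp [huniv, Finset.sum_pair hji.symm]
    have e1 := hm i i
    have e2 := hm i j
    have e3 := hm j i
    have e4 := hm j j
    simp only [Pi.single_eq_same, Pi.single_eq_of_ne hji, Pi.single_eq_of_ne hji.symm] at e1 e2 e3 e4
    rw [← Int.isUnit_iff]
    generalize c (Pi.single i 1) i = p at *
    generalize c (Pi.single i 1) j = q at *
    generalize c (Pi.single j 1) i = p' at *
    generalize c (Pi.single j 1) j = q' at *
    -- The matrix of `τ` has an integer inverse, and determinants multiply.
    refine IsUnit.of_mul_eq_one (p * q' - q * p') ?_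
    have : 1 * 1 - 0 * 0 = (p * τ i i + q * τ j i) * (p' * τ i j + q' * τ j j) -
        (p * τ i j + q * τ j j) * (p' * τ i i + q' * τ j i) := by rw [← e1, ← e2, ← e3, ← e4]
    linear_combination -this
  · push Not at h2
    have hr : ∀ d : ι → ℝ, range d = {d i} := fun d => by
      ext v
      constructor
      · rintro ⟨l, rfl⟩; rw [h2 l]; rfl
      · rintro rfl; exact mem_range_self i
    have hmem : d i ∈ AddSubgroup.closure (range d') :=
      hcl ▸ AddSubgroup.subset_closure (mem_range_self i)
    rw [hr d', AddSubgroup.mem_closure_singleton] at hmem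
    obtain ⟨m, hm⟩ := hmem
    rw [zsmul_eq_mul] at hm
    have hmpos : 0 < m := by
      have : 0 < (m : ℝ) * d' i := hm ▸ hd i
      exact_mod_cast (pos_iff_pos_of_mul_pos this).2 (hd' i)
    have hm1 : (1 : ℝ) ≤ m := by exact_mod_cast hmpos
    -- A single entry: `d i` is a positive multiple of `d' i` and not larger, so the two agree.
    have heq : d' i = d i := le_antisymm (by nlinarith [hd' i]) hle
    exact Linked.of_eq (wrap_congr _ _ heq fun l hl => absurd (h2 l) hl)

/-- Positive tuples that generate the same subgroup of `ℝ` are linked without enlarging the sum. -/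
theorem linked_of_closure_eq {d d' : ι → ℝ} (hd : ∀ l, 0 < d l) (hd' : ∀ l, 0 < d' l)
    (hB : ∑ l, d l ≤ B) (hB' : ∑ l, d' l ≤ B)
    (hcl : AddSubgroup.closure (range d) = AddSubgroup.closure (range d')) : Linked B d d' := by
  rcases isEmpty_or_nonempty ι with hι | hι
  · exact Linked.of_eq (Subsingleton.elim _ _)
  obtain ⟨i, hi⟩ := Finite.exists_min d
  obtain ⟨i', hi'⟩ := Finite.exists_min d'
  set e := Equiv.swap i i' with he
  refine Linked.trans ?_ (Linked.perm e hd' hB').symm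
  have h1 : ∀ l, d' (e i) ≤ d' (e l) := fun l => by
    rw [he, Equiv.swap_apply_left]; exact hi' _
  have h2 : ∑ l, d' (e l) ≤ B := by rwa [Equiv.sum_comp e d']
  have h3 : AddSubgroup.closure (range d) = AddSubgroup.closure (range fun l => d' (e l)) := by
    rw [hcl]
    congr 1
    exact (e.surjective.range_comp d').symm
  rcases le_total (d i) (d' (e i)) with hle | hle
  · exact linked_of_closure_eq_of_min hd (fun l => hd' _) hB h2 h3 hi h1 hle
  · exact (linked_of_closure_eq_of_min (fun l => hd' _) hd h2 hB h3.symm h1 hi hle).symm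

end linking

/-! ### From linked excesses to isotopic tori. -/

lemma minComp_le {n : ℕ} (a : Fin n → ℝ) (i : Fin n) : minComp a ≤ a i :=
  ciInf_le (finite_range a).bddBelow i

lemma exists_eq_minComp {n : ℕ} (hn : 1 ≤ n) (a : Fin n → ℝ) : ∃ i, a i = minComp a :=
  have : Nonempty (Fin n) := ⟨⟨0, hn⟩⟩
  exists_eq_ciInf_of_finite

lemma excessGroup_eq_closure {n : ℕ} (a : Fin n → ℝ) (μ : ℝ) (hμ : minComp a = μ)
    (p : Fin n → Prop) (hp : ∀ l, p l ↔ a l ≠ μ) :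
    excessGroup a = AddSubgroup.closure (range fun l : {l // p l} => a l - μ) := by
  subst hμ
  apply le_antisymm <;> rw [excessGroup, AddSubgroup.closure_le] <;> rintro _ ⟨l, rfl⟩
  · by_cases hl : a l = minComp a
    · simp [hl]
    · exact AddSubgroup.subset_closure ⟨⟨l, (hp l).2 hl⟩, rfl⟩
  · exact AddSubgroup.subset_closure ⟨l, rfl⟩

section extend

variable {n : ℕ} {p : Fin n → Prop} [DecidablePred p] {μ : ℝ}

/-- The vector with components `μ + e l` at the indices satisfying `p`, and `μ` elsewhere. -/
def extend (p : Fin n → Prop) [DecidablePred p] (μ : ℝ) (e : {l // p l} → ℝ) : Fin n → ℝ :=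
  fun l => if h : p l then μ + e ⟨l, h⟩ else μ

lemma extend_coe (e : {l // p l} → ℝ) (l : {l // p l}) : extend p μ e l = μ + e l := by
  simp [extend, l.2]

lemma extend_of_not (e : {l // p l} → ℝ) {l : Fin n} (hl : ¬p l) : extend p μ e l = μ := by
  simp [extend, hl]

lemma extend_pos (hμ : 0 < μ) {e : {l // p l} → ℝ} (he : ∀ l, 0 < e l) (l : Fin n) :
    0 < extend p μ e l := by
  unfold extend
  split_ifs
  · exact add_pos hμ (he _)
  · exact hμ

lemma total_extend (e : {l // p l} → ℝ) : total (extend p μ e) = n * μ + ∑ l, e l := by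
  have h : ∀ l, extend p μ e l = μ + if h : p l then e ⟨l, h⟩ else 0 := fun l => by
    unfold extend
    split_ifs <;> simp
  have h2 : ∑ l, (if h : p l then e ⟨l, h⟩ else 0) = ∑ l, e l := by
    rw [← Fintype.sum_subtype_add_sum_subtype p]
    have h3 : ∑ l : {l // ¬p l}, (if h : p l then e ⟨l, h⟩ else 0) = 0 :=
      Finset.sum_eq_zero fun l _ => dif_neg l.2
    rw [h3, add_zero]
    exact Finset.sum_congr rfl fun l _ => dif_pos l.2
  rw [total, Finset.sum_congr rfl fun l _ => h l, Finset.sum_add_distrib, h2]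
  simp

/-- Adding e_k to e_j is `hamIsotopic_update` with the minimal component at `i`. It needs the total
plus the component at `k`, which is (n + 1) μ plus the sum of the updated excesses. The alternative
`e = e'` absorbs reflexivity, which carries neither positivity nor a bound on the sum. -/
lemma hamIsotopic_of_linked (hμ : 0 < μ) {i : Fin n} (hi : ¬p i) {B b : ℝ}
    (hb : (n + 1) * μ + B ≤ b) {e e' : {l // p l} → ℝ} (h : Linked B e e') :
    e = e' ∨ HamIsotopicInBall b (torus (extend p μ e)) (torus (extend p μ e')) := by
  induction h with
  | rel e e' h =>
    right
    cases h with
    | add j k hjk he hB =>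
      have hij : i ≠ j := fun h => hi (h ▸ j.2)
      have hik : i ≠ k := fun h => hi (h ▸ k.2)
      have hsum : ∑ l, Function.update e j (e j + e k) l = ∑ l, e l + e k := by
        rw [Finset.sum_update_of_mem (Finset.mem_univ _)]
        have : ∑ l, e l = e j + ∑ l ∈ Finset.univ \ {j}, e l := by
          rw [← Finset.sum_update_of_mem (Finset.mem_univ _), Function.update_eq_self]
        rw [this]; ring
      have h1 := hamIsotopic_update hij hik (fun h => hjk (Subtype.ext h))
        (extend_pos (p := p) hμ he) (b := b)
        (by rw [extend_of_not e hi, extend_coe]; linarith [he j])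
        (by rw [total_extend, extend_coe]; linarith)
      convert h1 using 2
      ext l
      by_cases hl : l = j
      · subst hl
        rw [Function.update_self, extend_coe, extend_coe, extend_coe, extend_of_not e hi,
          Function.update_self]
        ring
      · rw [Function.update_of_ne hl]
        unfold extend
        split_ifs with hp
        · rw [Function.update_of_ne fun h => hl (congrArg Subtype.val h)]
        · rfl
    | perm σ he hB =>
      have h1 := hamIsotopic_perm (extend_pos (p := p) hμ he) (Equiv.Perm.ofSubtype σ) (b := b)
        (by rw [total_extend]; linarith)
      convert h1 using 2
      ext l
      by_cases hl : p l
      · rw [Equiv.Perm.ofSubtype_apply_of_mem σ hl, extend_coe]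
        exact extend_coe _ ⟨l, hl⟩
      · rw [Equiv.Perm.ofSubtype_apply_of_not_mem σ hl, extend_of_not _ hl, extend_of_not _ hl]
  | refl e => exact Or.inl rfl
  | symm e e' _ ih => exact ih.imp Eq.symm HamIsotopicInBall.symm
  | trans e e' e'' _ _ ih ih' =>
    rcases ih with rfl | ih
    · exact ih'
    rcases ih' with rfl | ih'
    · exact Or.inr ih
    · exact Or.inr (ih.trans ih')

end extend

end ProductTori

end

theorem theorem1p1 (n : ℕ) (hn : 1 ≤ n) (a a' : Fin n → ℝ)
    (ha : ∀ i, 0 < a i) (ha' : ∀ i, 0 < a' i) :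
    ((∃ σ : Equiv.Perm (Fin n), ∀ i, a' i = a (σ i)) →
      ProductTori.HamIsotopicInBall (ProductTori.total a)
        (ProductTori.torus a) (ProductTori.torus a')) ∧
    (ProductTori.Equivalent a a' →
      ProductTori.HamIsotopicInBall
        (max (ProductTori.enlargedTotal a) (ProductTori.enlargedTotal a'))
        (ProductTori.torus a) (ProductTori.torus a')) := by
  open ProductTori in
  classical
  refine ⟨?_, ?_⟩
  · rintro ⟨σ, hσ⟩
    rw [show a' = fun l => a (σ l) from funext hσ]
    exact hamIsotopic_perm ha σ le_rfl
  rintro ⟨hmin, hmult, hgroup⟩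
  set μ := minComp a with hμ
  set b := max (enlargedTotal a) (enlargedTotal a') with hb
  obtain ⟨i, hi⟩ := exists_eq_minComp hn a
  have hμpos : 0 < μ := by rw [hμ, ← hi]; exact ha i
  have htot : total a + μ ≤ b := le_max_left _ _
  have htot' : total a' + μ ≤ b := by rw [hmin]; exact le_max_right _ _
  -- Equal multiplicities allow the minimal components of `a'` to be moved to the places of those of
  -- `a`.
  obtain ⟨σ, hσ⟩ : ∃ σ : Equiv.Perm (Fin n), ∀ l, a' (σ l) ≠ μ ↔ a l ≠ μ := by
    rw [minMult, minMult, ← hmin] at hmult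
    obtain ⟨e⟩ : Nonempty ({l // a l = μ} ≃ {l // a' l = μ}) := Finite.card_eq.1 hmult
    refine ⟨e.extendSubtype, fun l => not_congr ⟨fun h => ?_, fun h => e.extendSubtype_mem l h⟩⟩
    by_contra hl
    exact e.extendSubtype_not_mem l hl h
  set c : Fin n → ℝ := fun l => a' (σ l) with hc
  have h1 : HamIsotopicInBall b (torus a') (torus c) :=
    hamIsotopic_perm ha' σ (by linarith)
  have hcmin : minComp c = μ := by
    rw [hmin]
    exact σ.surjective.iInf_comp a'
  have hcgroup : excessGroup c = excessGroup a' := by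
    have e : minComp c = minComp a' := by rw [hcmin, hmin]
    rw [excessGroup, excessGroup, e]
    congr 1
    exact σ.surjective.range_comp fun l => a' l - minComp a'
  have hctot : total c = total a' := Equiv.sum_comp σ a'
  have hext : ∀ x : Fin n → ℝ, (∀ l, x l ≠ μ ↔ a l ≠ μ) →
      extend (fun l => a l ≠ μ) μ (fun l => x l - μ) = x := fun x hx => by
    ext l
    by_cases hl : a l = μ
    · rw [extend_of_not _ (not_not.2 hl)]
      exact (not_not.1 fun h => (hx l).1 h hl).symm
    · rw [show l = ((⟨l, hl⟩ : {l // a l ≠ μ}) : Fin n) from rfl, extend_coe]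
      ring
  have hpos : ∀ x : Fin n → ℝ, minComp x = μ → (∀ l, x l ≠ μ ↔ a l ≠ μ) →
      ∀ l : {l // a l ≠ μ}, 0 < x l - μ := fun x hx hx' l => by
    have h1 := minComp_le x l
    rw [hx] at h1
    exact sub_pos.2 (lt_of_le_of_ne h1 ((hx' l).2 l.2).symm)
  have hsum : ∀ x : Fin n → ℝ, (∀ l, x l ≠ μ ↔ a l ≠ μ) → total x + μ ≤ b →
      ∑ l : {l // a l ≠ μ}, (x l - μ) ≤ b - (n + 1) * μ := fun x hx hxb => by
    have h1 := total_extend (p := fun l => a l ≠ μ) (μ := μ) (fun l => x l - μ)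
    rw [hext x hx] at h1
    linarith
  -- The budget for the excesses: the total is n μ plus their sum, and the enlarged total adds one
  -- more μ.
  have hL : Linked (b - (n + 1) * μ) (fun l : {l // a l ≠ μ} => a l - μ) (fun l => c l - μ) := by
    refine linked_of_closure_eq (hpos a rfl fun _ => Iff.rfl) (hpos c hcmin hσ)
      (hsum a (fun _ => Iff.rfl) htot) (hsum c hσ (by rw [hctot]; exact htot')) ?_
    rw [← excessGroup_eq_closure a μ rfl _ fun _ => Iff.rfl,
      ← excessGroup_eq_closure c μ hcmin _ fun l => (hσ l).symm, hcgroup, hgroup]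
  refine HamIsotopicInBall.trans ?_ h1.symm
  rcases hamIsotopic_of_linked hμpos (not_not.2 hi)
    (show ((n : ℝ) + 1) * μ + (b - (n + 1) * μ) ≤ b by linarith) hL with h | h
  · have h2 := hext c hσ
    rw [← h, hext a fun _ => Iff.rfl] at h2
    rw [← h2]
    exact HamIsotopicInBall.refl (torus_subset_ball ha (by linarith))
  · rwa [hext a fun _ => Iff.rfl, hext c hσ] at h
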